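/- Let $K$ be a field, $\underline{x}=(x_1,\dots,x_d)$, and call $f\in K[[\underline{x}]][y]$ a Weierstrass polynomial if it is monic in $y$ and all its coefficients other than the leading one are non-units of $K[[\underline{x}]]$ (so the constant $1$ is a Weierstrass polynomial). The Newton polytope $\Delta(f)\subset\mathbb{R}^{d}\times\mathbb{R}$ of $f=\sum a_{\mathbf{i},j}\underline{x}^{\mathbf{i}}y^j$ is the convex hull of $\bigcup_{a_{\mathbf{i},j}\neq 0}\bigl((\mathbf{i},j)+\mathbb{R}_{\ge 0}^{d+1}\bigr)$; it is polygonal if the maximal dimension of its compact faces is one. For an integer $k\ge 1$ and $\mathbf{q}\in\mathbb{Q}_{\ge 0}^d$, the elementary polytope $\{\mathbf{q}/k\}$ is the convex hull of $\{(\mathbf{q},0),(\mathbf{0},k)\}+\mathbb{R}_{\ge 0}^{d+1}$, with inclination $\frac1k\mathbf{q}$; also $\{\infty/k\}:=\Delta(y^k)=(\mathbf{0},k)+\mathbb{R}_{\ge 0}^{d+1}$ is an elementary polytope, with inclination $\infty$. A canonical representation of a Newton polytope $\Delta$ is an equality $\Delta=\sum_{i=1}^r\{\mathbf{q}_i/k_i\}$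 (Minkowski sum, $\mathbf{q}_i\in\mathbb{Q}_{\ge0}^d\cup\{\infty\}$, $k_i\ge 1$ integers) in which the inclinations are pairwise different. Theorem. Let $f\in K[[\underline{x}]][y]$ be a Weierstrass polynomial such that $\Delta(f)$ is polygonal with canonical representation $\sum_{i=1}^r\{\mathbf{q}_i/k_i\}$. Then $f=f_1\cdots f_r$, where $f_1,\dots,f_r\in K[[\underline{x}]][y]$ are Weierstrass polynomials, not necessarily irreducible, with $\Delta(f_i)=\{\mathbf{q}_i/k_i\}$ for $i=1,\dots,r$. -/

import Mathlib

open scoped Pointwise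

namespace NewtonPoly

/-- A Weierstrass polynomial over `K[[x₁, …, x_d]]`: a monic polynomial in `y` all of whose
coefficients other than the leading one are non-units. The constant polynomial `1` is one. -/
def IsWeierstrass {K : Type*} [Field K] {d : ℕ}
    (f : Polynomial (MvPowerSeries (Fin d) K)) : Prop :=
  f.Monic ∧ ∀ j < f.natDegree, ¬ IsUnit (f.coeff j)

/-- The Newton polytope in `ℝ^d × ℝ` of `f = ∑ a_{i,j} x^i y^j`: the convex hull of the union of
the translated orthants `(i, j) + ℝ_{≥0}^{d+1}` over all `(i, j)` with `a_{i,j} ≠ 0`. -/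
def newtonPolytope {K : Type*} [Field K] {d : ℕ}
    (f : Polynomial (MvPowerSeries (Fin d) K)) : Set ((Fin d → ℝ) × ℝ) :=
  convexHull ℝ (⋃ (i : Fin d →₀ ℕ) (j : ℕ) (_ : MvPowerSeries.coeff i (f.coeff j) ≠ 0),
    ({((fun a => (i a : ℝ)), (j : ℝ))} + Set.Ici (0 : (Fin d → ℝ) × ℝ)))

/-- The elementary Newton polytope `{q / k}`. For `q ∈ ℚ_{≥0}^d` it is the convex hull of
`{(q, 0), (0, k)} + ℝ_{≥0}^{d+1}`; for `q = ∞` (written `⊤`) it is `(0, k) + ℝ_{≥0}^{d+1}`. -/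
def elementary {d : ℕ} (q : WithTop (Fin d → ℚ≥0)) (k : ℕ) : Set ((Fin d → ℝ) × ℝ) :=
  match q with
  | ⊤ => {((0 : Fin d → ℝ), (k : ℝ))} + Set.Ici 0
  | (q : Fin d → ℚ≥0) =>
      convexHull ℝ ({((fun a => ((q a : ℚ) : ℝ)), (0 : ℝ)), ((0 : Fin d → ℝ), (k : ℝ))}
        + Set.Ici 0)

/-- The inclination `q / k` of the elementary polytope `{q / k}`, equal to `∞` for `q = ∞`. -/
def inclination {d : ℕ} (q : WithTop (Fin d → ℚ≥0)) (k : ℕ) : WithTop (Fin d → ℚ≥0) :=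
  q.map fun v a => v a / (k : ℚ≥0)

/-- `P` is polygonal: the maximal dimension of its compact (nonempty) faces is one. Faces are cut
out by supporting hyperplanes, and the dimension is that of the affine span. -/
def IsPolygonal {d : ℕ} (P : Set ((Fin d → ℝ) × ℝ)) : Prop :=
  IsGreatest {n : ℕ | ∃ F : Set ((Fin d → ℝ) × ℝ), IsExposed ℝ P F ∧ F.Nonempty ∧ IsCompact F ∧
    Module.finrank ℝ (vectorSpan ℝ F) = n} 1

/-- `P = ∑ {q i / k i}` (Minkowski sum) is a canonical representation: the `k i` are positive
integers and terms of equal inclination have been summed up, so that the inclinations are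
pairwise different. -/
def IsCanonicalRep {d r : ℕ} (P : Set ((Fin d → ℝ) × ℝ))
    (q : Fin r → WithTop (Fin d → ℚ≥0)) (k : Fin r → ℕ) : Prop :=
  (∀ i, 0 < k i) ∧ (Function.Injective fun i => inclination (q i) (k i)) ∧
    P = ∑ i, elementary (q i) (k i)

end NewtonPoly

/-! Polygonality forces the finite inclinations to form a chain in the coordinatewise order. If two
were incomparable, some linear form with positive coefficients would be constant on both
corresponding edges, and the compact face it cuts out would contain two independent directions
(`comparable_of_isPolygonal`).

Infinite inclinations account for a power of `y`, and zero inclination for the factor `1`, since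
`{0/k}` is the whole orthant. For the rest, a linear form in general position shows that each vertex
of the polytope is a monomial of `f` (`exists_support_vertex`). This yields the data `HasSlopes`:
lower bounds along every edge, attained at the vertices.

The largest slope is then split off (`HasSlopes.split`) by a Hensel-type iteration at the vertex
where its edge meets the next one (`exists_factor_of_vertex`). The coefficient `b` at that vertex is
a monomial times a unit, so it can be divided out exactly, and every correction gains a fixed
positive weight. No coprimality of initial forms is needed. A slope is a vector, and all weight
estimates hold in each coordinate simultaneously. Induction on the number of slopes finishes the
factorization, and `HasSlope.newtonPolytope_eq` reads off the polytope of each factor. -/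

namespace NewtonPoly

open Polynomial

/-! ### Weights, division and Hensel-type factorization at a vertex. -/

section Weight

variable {K σ : Type*} [Field K]

/-- Every monomial `x^i y^j` of `P` satisfies `c ≤ i + j w` coordinatewise. -/
def WeightGE (w c : σ → ℝ) (P : (MvPowerSeries σ K)[X]) : Prop :=
  ∀ i j, MvPowerSeries.coeff i (P.coeff j) ≠ 0 → ∀ a, c a ≤ i a + j * w a

theorem exists_of_coeff_mul_ne_zero {P R : (MvPowerSeries σ K)[X]} {i : σ →₀ ℕ} {j : ℕ}
    (h : MvPowerSeries.coeff i ((P * R).coeff j) ≠ 0) :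
    ∃ i₁ i₂ j₁ j₂, i₁ + i₂ = i ∧ j₁ + j₂ = j ∧ MvPowerSeries.coeff i₁ (P.coeff j₁) ≠ 0 ∧
      MvPowerSeries.coeff i₂ (R.coeff j₂) ≠ 0 := by
  classical
  rw [Polynomial.coeff_mul, map_sum] at h
  obtain ⟨⟨j₁, j₂⟩, hj, h⟩ := Finset.exists_ne_zero_of_sum_ne_zero h
  rw [MvPowerSeries.coeff_mul] at h
  obtain ⟨⟨i₁, i₂⟩, hi, h⟩ := Finset.exists_ne_zero_of_sum_ne_zero h
  exact ⟨i₁, i₂, j₁, j₂, by simpa using hi, by simpa using hj, left_ne_zero_of_mul h,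
    right_ne_zero_of_mul h⟩

namespace WeightGE

variable {w c c' : σ → ℝ} {P R : (MvPowerSeries σ K)[X]}

theorem zero (w c : σ → ℝ) : WeightGE w c (0 : (MvPowerSeries σ K)[X]) := by
  intro i j h; simp at h

theorem mono (hP : WeightGE w c P) (h : ∀ a, c' a ≤ c a) : WeightGE w c' P :=
  fun i j hij a => (h a).trans (hP i j hij a)

theorem neg (hP : WeightGE w c P) : WeightGE w c (-P) := by
  intro i j h
  exact hP i j (by simpa using h)

theorem add (hP : WeightGE w c P) (hR : WeightGE w c R) : WeightGE w c (P + R) := by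
  intro i j h
  by_cases h1 : MvPowerSeries.coeff i (P.coeff j) = 0
  · exact hR i j (by simpa [h1] using h)
  · exact hP i j h1

theorem sub (hP : WeightGE w c P) (hR : WeightGE w c R) : WeightGE w c (P - R) := by
  rw [sub_eq_add_neg]; exact hP.add hR.neg

theorem mul (hP : WeightGE w c P) (hR : WeightGE w c' R) : WeightGE w (c + c') (P * R) := by
  intro i j h a
  obtain ⟨i₁, i₂, j₁, j₂, rfl, rfl, h1, h2⟩ := exists_of_coeff_mul_ne_zero h
  have e1 := hP _ _ h1 a
  have e2 := hR _ _ h2 a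
  push_cast [Finsupp.add_apply, Pi.add_apply]
  linarith

theorem C_mul (b : MvPowerSeries σ K) (hP : WeightGE w c P) : WeightGE w c (C b * P) := by
  have : WeightGE w 0 (C b) := by
    intro i j h a
    rw [coeff_C] at h
    split_ifs at h with hj
    · simp [hj]
    · simp at h
  simpa using this.mul hP

/-- Division by a monic polynomial of pure weight respects weights. -/
theorem exists_div_mod {h : (MvPowerSeries σ K)[X]} (hm : h.Monic)
    (hh : WeightGE w (fun a => h.natDegree * w a) h) :
    WeightGE w c P → ∃ q r, r + h * q = P ∧ r.degree < h.degree ∧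
      WeightGE w (fun a => c a - h.natDegree * w a) q ∧ WeightGE w c r := by
  induction P using degree_lt_wf.induction with
  | _ P ih =>
  intro hP
  by_cases hd : P.degree < h.degree
  · exact ⟨0, P, by simp, hd, zero _ _, hP⟩
  have hP0 : P ≠ 0 := by
    rintro rfl
    exact hd (by simpa [bot_lt_iff_ne_bot] using hm.ne_zero)
  have hle : h.degree ≤ P.degree := not_lt.mp hd
  have hlt := div_wf_lemma ⟨hle, hP0⟩ hm
  have hn : h.natDegree ≤ P.natDegree := natDegree_le_natDegree hle
  -- One step of long division: lowering the `y`-degree of the leading term by `h.natDegree` costs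
  -- exactly `h.natDegree * w`, which multiplication by `h` restores.
  set T := C P.leadingCoeff * X ^ (P.natDegree - h.natDegree) with hT
  have hTw : WeightGE w (fun a => c a - h.natDegree * w a) T := by
    intro i j hij a
    rw [hT, coeff_C_mul_X_pow] at hij
    split_ifs at hij with hj
    · have := hP i P.natDegree hij a
      rw [hj]
      push_cast [hn]
      linarith
    · simp at hij
  have hhT : WeightGE w c (h * T) := (hh.mul hTw).mono fun a => by simp
  obtain ⟨q, r, e, hr, hq, hrw⟩ := ih _ hlt (hP.sub hhT)
  exact ⟨q + T, r, by linear_combination e, hr, hq.add hTw, hrw⟩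

theorem divByMonic {h : (MvPowerSeries σ K)[X]} (hm : h.Monic)
    (hh : WeightGE w (fun a => h.natDegree * w a) h) (hP : WeightGE w c P) :
    WeightGE w (fun a => c a - h.natDegree * w a) (P /ₘ h) := by
  obtain ⟨q, r, e, hr, hq, -⟩ := exists_div_mod hm hh hP
  rwa [(div_modByMonic_unique q r hm ⟨e, hr⟩).1]

theorem modByMonic {h : (MvPowerSeries σ K)[X]} (hm : h.Monic)
    (hh : WeightGE w (fun a => h.natDegree * w a) h) (hP : WeightGE w c P) :
    WeightGE w c (P %ₘ h) := by
  obtain ⟨q, r, e, hr, -, hr'⟩ := exists_div_mod hm hh hP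
  rwa [(div_modByMonic_unique q r hm ⟨e, hr⟩).2]

end WeightGE

/-- Weights tending to infinity in one coordinate force a polynomial to vanish. -/
theorem eq_zero_of_weightGE {w c ε : σ → ℝ} {a : σ} (ha : 0 < ε a) {P : (MvPowerSeries σ K)[X]}
    (h : ∀ n : ℕ, WeightGE w (fun a => c a + n * ε a) P) : P = 0 := by
  ext j i
  by_contra hne
  obtain ⟨n, hn⟩ := exists_nat_gt ((i a + j * w a - c a) / ε a)
  rw [div_lt_iff₀ ha] at hn
  have := h n i j (by simpa using hne) a
  simp only at this
  linarith

/-- A power series all of whose exponents are at least `Q` is a multiple of `x^Q`. -/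
theorem exists_monomial_mul_eq {χ : MvPowerSeries σ K} {Q : σ →₀ ℕ}
    (hχ : ∀ i, MvPowerSeries.coeff i χ ≠ 0 → Q ≤ i) :
    ∃ χ', χ = MvPowerSeries.monomial Q 1 * χ' := by
  classical
  obtain ⟨χ', hχ'⟩ : ∃ χ' : MvPowerSeries σ K, ∀ i,
      MvPowerSeries.coeff i χ' = MvPowerSeries.coeff (Q + i) χ :=
    ⟨fun i => MvPowerSeries.coeff (Q + i) χ, fun i => rfl⟩
  refine ⟨χ', ?_⟩
  ext i
  rw [MvPowerSeries.coeff_monomial_mul]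
  split_ifs with h
  · rw [one_mul, hχ', add_tsub_cancel_of_le h]
  · by_contra hne
    exact h (hχ i hne)

/-- Exact division of a polynomial by a coefficient with dominant monomial `x^Q`. -/
theorem WeightGE.exists_C_mul_eq {w c : σ → ℝ} (hw : ∀ a, 0 ≤ w a) {b : MvPowerSeries σ K}
    {Q : σ →₀ ℕ} {m : ℕ} (hb : MvPowerSeries.coeff Q b ≠ 0)
    (hbQ : ∀ i, MvPowerSeries.coeff i b ≠ 0 → Q ≤ i) {P : (MvPowerSeries σ K)[X]}
    (hdeg : P.natDegree ≤ m) (hc : ∀ a, m * w a ≤ c a)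
    (hP : WeightGE w (fun a => Q a + c a) P) :
    ∃ R, P = C b * R ∧ WeightGE w c R := by
  classical
  obtain ⟨u, rfl⟩ := exists_monomial_mul_eq hbQ
  have hu : MvPowerSeries.constantCoeff u ≠ 0 := by
    have := MvPowerSeries.coeff_add_monomial_mul Q 0 u (1 : K)
    rw [add_zero, one_mul] at this
    rwa [← MvPowerSeries.coeff_zero_eq_constantCoeff_apply, ← this]
  have hdiv : ∀ j, MvPowerSeries.monomial Q (1 : K) ∣ P.coeff j := by
    intro j
    refine exists_monomial_mul_eq fun i hi a => ?_
    have hj : j ≤ m := (le_natDegree_of_ne_zero fun h0 => hi (by simp [h0])).trans hdeg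
    have h1 := hP i j hi a
    have h2 : (j : ℝ) * w a ≤ m * w a :=
      mul_le_mul_of_nonneg_right (by exact_mod_cast hj) (hw a)
    have h3 := hc a
    have : (Q a : ℝ) ≤ i a := by simp only at h1; linarith
    exact_mod_cast this
  obtain ⟨R, rfl⟩ := (C_dvd_iff_dvd_coeff _ _).mpr hdiv
  refine ⟨C u⁻¹ * R, ?_, WeightGE.C_mul _ fun i j hij a => ?_⟩
  · rw [Polynomial.C_mul, mul_assoc, ← mul_assoc (C u), ← Polynomial.C_mul, MvPowerSeries.mul_inv_cancel u hu]
    simp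
  · have := hP (Q + i) j (by
      rwa [coeff_C_mul, MvPowerSeries.coeff_add_monomial_mul, one_mul]) a
    push_cast [Finsupp.add_apply] at this
    linarith

/-- A sequence of polynomials of bounded degree whose successive differences have weights growing
linearly in one coordinate has a limit. -/
theorem exists_limit {w c ε : σ → ℝ} (hε : ∀ a, 0 ≤ ε a) {a : σ} (ha : 0 < ε a) {m : ℕ}
    (h : ℕ → (MvPowerSeries σ K)[X]) (hdeg : ∀ n, (h (n + 1) - h n).degree < m)
    (hw : ∀ n : ℕ, WeightGE w (fun a => c a + n * ε a) (h (n + 1) - h n)) :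
    ∃ H, ∀ n : ℕ, (H - h n).degree < m ∧ WeightGE w (fun a => c a + n * ε a) (H - h n) := by
  have hdiff : ∀ n l : ℕ, (h (n + l) - h n).degree < m ∧
      WeightGE w (fun a => c a + n * ε a) (h (n + l) - h n) := by
    intro n l
    induction l with
    | zero => simpa [bot_lt_iff_ne_bot] using WeightGE.zero _ _
    | succ l ih =>
      have e : h (n + (l + 1)) - h n = (h (n + l + 1) - h (n + l)) + (h (n + l) - h n) := by
        rw [add_assoc]; ring
      rw [e]
      refine ⟨(degree_add_le _ _).trans_lt (max_lt (hdeg _) ih.1), ((hw (n + l)).mono fun b => ?_).add ih.2⟩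
      have := hε b
      push_cast
      nlinarith [mul_nonneg (Nat.cast_nonneg (α := ℝ) l) this]
  -- From level `N i j` on, differences have weight above that of `x^i y^j`, so this coefficient is
  -- stationary and defines the limit.
  choose N hN using fun (i : σ →₀ ℕ) (j : ℕ) => exists_nat_gt ((i a + j * w a - c a) / ε a)
  obtain ⟨co, hco⟩ : ∃ co : ℕ → MvPowerSeries σ K, ∀ i j,
      MvPowerSeries.coeff i (co j) = MvPowerSeries.coeff i ((h (N i j)).coeff j) :=
    ⟨fun j i => MvPowerSeries.coeff i ((h (N i j)).coeff j), fun i j => rfl⟩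
  have hdegz : ∀ n j, m ≤ j → (h n).coeff j = (h 0).coeff j := by
    intro n j hj
    have h1 := (hdiff 0 n).1
    rw [zero_add] at h1
    have := coeff_eq_zero_of_degree_lt (h1.trans_le (by exact_mod_cast hj))
    rwa [coeff_sub, sub_eq_zero] at this
  set H : (MvPowerSeries σ K)[X] :=
    ∑ j ∈ Finset.range (m + (h 0).natDegree + 1), C (co j) * X ^ j with hH
  have hHc : ∀ i j, MvPowerSeries.coeff i (H.coeff j) =
      MvPowerSeries.coeff i ((h (N i j)).coeff j) := by
    intro i j
    rw [hH, finsetSum_coeff]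
    simp only [coeff_C_mul_X_pow]
    rw [Finset.sum_ite_eq]
    split_ifs with hj
    · exact hco i j
    · rw [Finset.mem_range, not_lt] at hj
      rw [hdegz _ j (by omega), coeff_eq_zero_of_natDegree_lt (p := h 0) (by omega)]
  refine ⟨H, fun n => ⟨?_, ?_⟩⟩
  · rw [degree_lt_iff_coeff_zero]
    intro j hj
    ext i
    rw [coeff_sub, map_sub, hHc, hdegz _ j hj, hdegz n j hj]
    simp
  · intro i j hij b
    rw [coeff_sub, map_sub, hHc, ← map_sub, ← coeff_sub] at hij
    rcases le_total n (N i j) with hn | hn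
    · obtain ⟨l, hl⟩ := Nat.exists_eq_add_of_le hn
      rw [hl] at hij
      exact (hdiff n l).2 i j hij b
    · exfalso
      obtain ⟨l, hl⟩ := Nat.exists_eq_add_of_le hn
      have := (hdiff (N i j) l).2 i j (by
        rw [← hl, coeff_sub, map_sub]
        rw [coeff_sub, map_sub] at hij
        rw [← neg_sub, neg_ne_zero]
        exact hij) a
      have h2 := hN i j
      rw [div_lt_iff₀ ha] at h2
      linarith

/-- Hensel-type factorization at a vertex of the Newton polytope. -/
theorem exists_factor_of_vertex {w ε : σ → ℝ} (hw : ∀ a, 0 ≤ w a) (hε : ∀ a, 0 ≤ ε a)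
    {a₀ : σ} (ha₀ : 0 < ε a₀) {f : (MvPowerSeries σ K)[X]} {Q : σ →₀ ℕ}
    {m : ℕ} (hQ : MvPowerSeries.coeff Q (f.coeff m) ≠ 0)
    (hfw : WeightGE w (fun a => Q a + m * w a) f)
    (hhigh : ∀ i j, m < j → MvPowerSeries.coeff i (f.coeff j) ≠ 0 → ∀ a,
      Q a + m * w a + ε a ≤ i a + j * w a) :
    ∃ g h, f = g * h ∧ h.Monic ∧ h.natDegree = m ∧ WeightGE w (fun a => m * w a) h := by
  classical
  set b := f.coeff m with hb
  have hbQ : ∀ i, MvPowerSeries.coeff i b ≠ 0 → Q ≤ i := by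
    intro i hi a
    have := hfw i m hi a
    have : (Q a : ℝ) ≤ i a := by simp only at this; linarith
    exact_mod_cast this
  have hb0 : b ≠ 0 := fun h => hQ (by simp [h])
  -- Terms above `y^m` have extra weight `ε`, so `lo = b * h₀` is a first approximation to `f`, with
  -- `h₀` monic of degree `m`.
  set lo : (MvPowerSeries σ K)[X] := ∑ j ∈ Finset.range (m + 1), C (f.coeff j) * X ^ j with hlo
  have hloc : ∀ j, lo.coeff j = if j ≤ m then f.coeff j else 0 := by
    intro j
    rw [hlo, finsetSum_coeff]
    simp only [coeff_C_mul_X_pow]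
    rw [Finset.sum_ite_eq]
    simp
  have hlodeg : lo.natDegree ≤ m := by
    rw [natDegree_le_iff_coeff_eq_zero]
    intro j hj
    rw [hloc, if_neg (by omega)]
  have hlow : WeightGE w (fun a => Q a + m * w a) lo := by
    intro i j hij
    rw [hloc] at hij
    split_ifs at hij with hj
    · exact hfw i j hij
    · simp at hij
  have hhi : WeightGE w (fun a => Q a + m * w a + ε a) (f - lo) := by
    intro i j hij
    rw [coeff_sub, hloc] at hij
    split_ifs at hij with hj
    · simp at hij
    · exact hhigh i j (by omega) (by simpa using hij)
  obtain ⟨h₀, hh₀, hh₀w⟩ := WeightGE.exists_C_mul_eq hw hQ hbQ hlodeg (fun a => le_rfl) hlow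
  have hh₀m : h₀.coeff m = 1 := by
    have := congrArg (fun p => p.coeff m) hh₀
    simp only [coeff_C_mul, hloc, le_refl, if_true] at this
    exact (mul_left_cancel₀ hb0 (by rw [mul_one]; exact this)).symm
  have hh₀d : h₀.natDegree ≤ m := by
    rwa [hh₀, natDegree_C_mul hb0] at hlodeg
  -- the approximate factors at level `n`
  let Good : ℕ → (MvPowerSeries σ K)[X] → Prop := fun n h =>
    h.Monic ∧ h.natDegree = m ∧ WeightGE w (fun a => m * w a) h ∧
    WeightGE w (fun a => Q a + m * w a + (n + 1 : ℕ) * ε a) (f %ₘ h) ∧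
    WeightGE w (fun a => Q a + ε a) (f /ₘ h - C b)
  -- An approximate factorization suffices: dividing the error `E` by `h` changes the quotient only
  -- by terms of weight at least `Q + ε`.
  have good_of : ∀ (n : ℕ) (h g E : (MvPowerSeries σ K)[X]), h.Monic → h.natDegree = m →
      WeightGE w (fun a => m * w a) h → f = g * h + E → WeightGE w (fun a => Q a + ε a) (g - C b) →
      WeightGE w (fun a => Q a + m * w a + (n + 1 : ℕ) * ε a) E → Good n h := by
    intro n h g E hm hd hwt hf hg hE
    have hwt' : WeightGE w (fun a => h.natDegree * w a) h := by rw [hd]; exact hwt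
    have e : (E %ₘ h) + h * (g + E /ₘ h) = f := by
      rw [hf]; linear_combination modByMonic_add_div E h
    obtain ⟨e1, e2⟩ := div_modByMonic_unique _ _ hm ⟨e, degree_modByMonic_lt E hm⟩
    refine ⟨hm, hd, hwt, ?_, ?_⟩
    · rw [e2]
      exact WeightGE.modByMonic hm hwt' hE
    · rw [e1, add_sub_right_comm]
      refine hg.add ((WeightGE.divByMonic hm hwt' hE).mono fun a => ?_)
      have := hε a
      rw [hd]
      push_cast
      nlinarith [mul_nonneg (Nat.cast_nonneg (α := ℝ) n) this]
  have hm₀ : h₀.Monic := monic_of_natDegree_le_of_coeff_eq_one m hh₀d hh₀m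
  have good₀ : Good 0 h₀ := by
    refine good_of 0 h₀ (C b) (f - lo) hm₀
      (le_antisymm hh₀d (le_natDegree_of_ne_zero (by rw [hh₀m]; exact one_ne_zero))) hh₀w
      (by rw [hh₀]; ring) (by rw [sub_self]; exact WeightGE.zero _ _) ?_
    exact hhi.mono fun a => by simp
  -- Put `ρ = (f %ₘ h) / b` and `g = f /ₘ h`. Then `f - g (h + ρ) = -(g - b) ρ`, and the factor `g -
  -- b` contributes one more `ε`.
  have step : ∀ (n : ℕ) (h : (MvPowerSeries σ K)[X]), Good n h → ∃ h', Good (n + 1) h' ∧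
      (h' - h).degree < m ∧ WeightGE w (fun a => m * w a + n * ε a) (h' - h) := by
    rintro n h ⟨hm, hd, hwt, hr, hg⟩
    have hrd : (f %ₘ h).degree < m := by
      rw [← hd, ← degree_eq_natDegree hm.ne_zero]
      exact degree_modByMonic_lt f hm
    obtain ⟨ρ, hρ, hρw⟩ := WeightGE.exists_C_mul_eq (c := fun a => m * w a + (n + 1 : ℕ) * ε a)
      hw hQ hbQ (natDegree_le_of_degree_le hrd.le)
      (fun a => by have := mul_nonneg (Nat.cast_nonneg (α := ℝ) (n + 1)) (hε a); linarith)
      (hr.mono fun a => by linarith)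
    have hρd : ρ.degree < m := by
      rw [hρ, degree_C_mul hb0] at hrd
      exact hrd
    have hρh : ρ.degree < h.degree := by rwa [degree_eq_natDegree hm.ne_zero, hd]
    have hρw' : WeightGE w (fun a => m * w a) ρ := hρw.mono fun a => by
      have := mul_nonneg (Nat.cast_nonneg (α := ℝ) (n + 1)) (hε a); linarith
    refine ⟨h + ρ, good_of (n + 1) (h + ρ) (f /ₘ h) (-((f /ₘ h - C b) * ρ)) (hm.add_of_left hρh)
      ?_ (hwt.add hρw') ?_ hg ?_, ?_, ?_⟩
    · rw [natDegree_add_eq_left_of_degree_lt hρh, hd]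
    · linear_combination -modByMonic_add_div f h + hρ
    · refine (hg.mul hρw).neg.mono fun a => ?_
      simp only [Pi.add_apply]
      push_cast
      linarith
    · simpa using hρd
    · rw [add_sub_cancel_left]
      refine hρw.mono fun a => ?_
      have := hε a
      push_cast
      linarith
  choose! next hnext using step
  let seq : ℕ → (MvPowerSeries σ K)[X] := fun n => Nat.rec h₀ next n
  have hseq : ∀ n, Good n (seq n) := by
    intro n
    induction n with
    | zero => exact good₀
    | succ n ih => exact (hnext n _ ih).1
  obtain ⟨h, hh⟩ := exists_limit hε ha₀ seq (fun n => (hnext n _ (hseq n)).2.1)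
    (fun n => (hnext n _ (hseq n)).2.2)
  have hd₀ : (h - h₀).degree < h₀.degree := by
    rw [degree_eq_natDegree hm₀.ne_zero, good₀.2.1]; exact (hh 0).1
  have ehh : h = h₀ + (h - h₀) := by ring
  have hm : h.Monic := by rw [ehh]; exact hm₀.add_of_left hd₀
  have hd : h.natDegree = m := by
    rw [ehh, natDegree_add_eq_left_of_degree_lt hd₀, good₀.2.1]
  have hwt : WeightGE w (fun a => m * w a) h := by
    rw [ehh]
    exact hh₀w.add ((hh 0).2.mono fun a => by simp)
  have hwt' : WeightGE w (fun a => h.natDegree * w a) h := by rw [hd]; exact hwt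
  -- The remainder by the limit is also the remainder of an error `E` of weight at least `Q + m w +
  -- n ε`, for every `n`.
  have hr : f %ₘ h = 0 := by
    refine eq_zero_of_weightGE (w := w) (c := fun a => Q a + m * w a) ha₀ fun n => ?_
    obtain ⟨hnm, hnd, hnw, hnr, hng⟩ := hseq n
    have hgw : WeightGE w (fun a => (Q a : ℝ)) (f /ₘ seq n) :=
      (WeightGE.divByMonic hnm (by rw [hnd]; exact hnw) hfw).mono fun a => by rw [hnd]; simp
    set E := f %ₘ seq n - (f /ₘ seq n) * (h - seq n) with hE
    have hEw : WeightGE w (fun a => Q a + m * w a + n * ε a) E := by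
      refine (hnr.mono fun a => ?_).sub ((hgw.mul (hh n).2).mono fun a => ?_)
      · have := hε a
        push_cast
        linarith
      · simp only [Pi.add_apply]; linarith
    have e : (E %ₘ h) + h * (f /ₘ seq n + E /ₘ h) = f := by
      linear_combination modByMonic_add_div E h + modByMonic_add_div f (seq n) + hE
    rw [(div_modByMonic_unique _ _ hm ⟨e, degree_modByMonic_lt E hm⟩).2]
    exact WeightGE.modByMonic hm hwt' hEw
  refine ⟨f /ₘ h, h, ?_, hm, hd, hwt⟩
  have := modByMonic_add_div f h
  rw [hr, zero_add] at this
  rw [mul_comm, this]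

end Weight

/-! ### Splitting off slopes one at a time. -/

section Slopes

variable {K σ ι : Type*} [Field K]

/-- A monic polynomial of pure weight `v` has pure weight `w` for every `w ≤ v`. -/
theorem WeightGE.of_le {v w : σ → ℝ} (hle : w ≤ v) {h : (MvPowerSeries σ K)[X]}
    (hv : WeightGE v (fun a => h.natDegree * v a) h) :
    WeightGE w (fun a => h.natDegree * w a) h := by
  intro i j hij a
  have h1 := hv i j hij a
  have hj : j ≤ h.natDegree := le_natDegree_of_ne_zero fun h0 => hij (by simp [h0])
  have hj' : (0 : ℝ) ≤ (h.natDegree : ℝ) - j := by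
    rw [sub_nonneg]; exact_mod_cast hj
  have := mul_le_mul_of_nonneg_left (hle a) hj'
  simp only at h1
  linarith

open Classical in
/-- The bounds and vertices prescribed by a chain of slopes `v t` with multiplicities `k t`. -/
structure HasSlopes (S : Finset ι) (v : ι → σ → ℝ) (k : ι → ℕ)
    (f : (MvPowerSeries σ K)[X]) : Prop where
  monic : f.Monic
  natDegree_eq : f.natDegree = ∑ t ∈ S, k t
  weight : ∀ s ∈ S, WeightGE (v s) (fun a => ∑ t ∈ S, k t * min (v t a) (v s a)) f
  vertex : ∀ s ∈ S, ∃ i : σ →₀ ℕ,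
    MvPowerSeries.coeff i (f.coeff (∑ t ∈ S with ¬ v t ≤ v s, k t)) ≠ 0 ∧
      ∀ a, (i a : ℝ) = ∑ t ∈ S with v t ≤ v s, k t * v t a

/-- `f` has a single slope `v` of multiplicity `k`. -/
structure HasSlope (v : σ → ℝ) (k : ℕ) (f : (MvPowerSeries σ K)[X]) : Prop where
  monic : f.Monic
  natDegree_eq : f.natDegree = k
  weight : WeightGE v (fun a => k * v a) f
  vertex : ∃ i : σ →₀ ℕ, MvPowerSeries.coeff i (f.coeff 0) ≠ 0 ∧ ∀ a, (i a : ℝ) = k * v a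

/-- Here `v M` is the largest slope and `v s` the next one. The vertex attached to `s` ends the
`M`-edge, and the factorization at that vertex separates this edge from all the others. -/
theorem HasSlopes.split {S : Finset ι} {v : ι → σ → ℝ} {k : ι → ℕ} (hv : ∀ t a, 0 ≤ v t a)
    {M s : ι} (hM : M ∉ S) (hlt : ∀ t ∈ S, v t < v M) (hs : s ∈ S) (hmax : ∀ t ∈ S, v t ≤ v s)
    (hchain : ∀ s ∈ S, ∀ t ∈ S, v s ≤ v t ∨ v t ≤ v s)
    {f : (MvPowerSeries σ K)[X]} [DecidableEq ι] (hf : HasSlopes (insert M S) v k f) :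
    ∃ g h, f = g * h ∧ HasSlopes S v k g ∧ HasSlope (v M) (k M) h := by
  classical
  have hMs : ¬ v M ≤ v s := (hlt s hs).not_ge
  obtain ⟨Q, hQ, hQa⟩ := hf.vertex s (Finset.mem_insert_of_mem hs)
  have hS1 : (insert M S).filter (fun t => ¬ v t ≤ v s) = {M} := by
    ext t
    simp only [Finset.mem_filter, Finset.mem_insert, Finset.mem_singleton]
    constructor
    · rintro ⟨rfl | h, h'⟩
      · rfl
      · exact absurd (hmax t h) h'
    · rintro rfl; exact ⟨Or.inl rfl, hMs⟩
  have hS2 : (insert M S).filter (fun t => v t ≤ v s) = S := by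
    rw [Finset.filter_insert, if_neg hMs, Finset.filter_true_of_mem hmax]
  rw [hS1, Finset.sum_singleton] at hQ
  rw [hS2] at hQa
  have hwM : WeightGE (v M) (fun a => Q a + k M * v M a) f :=
    (hf.weight M (Finset.mem_insert_self _ _)).mono fun a => by
      rw [Finset.sum_insert hM, min_self, hQa, add_comm]
      exact (congrArg _ (Finset.sum_congr rfl fun t ht => by
        rw [min_eq_left ((hlt t ht).le a)])).le
  have hws : WeightGE (v s) (fun a => Q a + k M * v s a) f :=
    (hf.weight s (Finset.mem_insert_of_mem hs)).mono fun a => by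
      rw [Finset.sum_insert hM, min_eq_right ((hlt s hs).le a), hQa, add_comm]
      exact (congrArg _ (Finset.sum_congr rfl fun t ht => by
        rw [min_eq_left (hmax t ht a)])).le
  obtain ⟨hle, a₀, ha₀⟩ := Pi.lt_def.mp (hlt s hs)
  -- The gap is `ε = v M - v s`: the bound for `v s`, rewritten with slope `v M`, gains `(j - k M) *
  -- ε` above height `k M`.
  obtain ⟨g, h, rfl, hm, hd, hhw⟩ := exists_factor_of_vertex (w := v M)
    (ε := fun a => v M a - v s a) (hv M) (fun a => sub_nonneg.mpr (hle a)) (a₀ := a₀)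
    (sub_pos.mpr ha₀) hQ hwM (by
      intro i j hj hij a
      have h1 := hws i j hij a
      have h2 : (k M : ℝ) + 1 ≤ j := by exact_mod_cast hj
      have h3 := mul_le_mul_of_nonneg_right h2 (sub_nonneg.mpr (hle a))
      simp only at h1
      linarith)
  have hg : g.Monic := hm.of_mul_monic_right hf.monic
  have hhw' : WeightGE (v M) (fun a => h.natDegree * v M a) h := by rw [hd]; exact hhw
  have hgdiv : (g * h) /ₘ h = g := by rw [mul_comm]; exact mul_divByMonic_cancel_left g hm
  have hgw : ∀ t ∈ S, WeightGE (v t) (fun a => ∑ u ∈ S, k u * min (v u a) (v t a)) g := by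
    intro t ht
    have := WeightGE.divByMonic hm (hhw'.of_le (hlt t ht).le)
      (hf.weight t (Finset.mem_insert_of_mem ht))
    rw [hgdiv] at this
    refine this.mono fun a => ?_
    rw [Finset.sum_insert hM, min_eq_right ((hlt t ht).le a), hd]
    simp
  refine ⟨g, h, rfl, ⟨hg, ?_, hgw, ?_⟩, hm, hd, hhw, ?_⟩
  · have := hf.natDegree_eq
    rw [hg.natDegree_mul hm, Finset.sum_insert hM, hd] at this
    omega
  · intro t ht
    obtain ⟨i, hi, hia⟩ := hf.vertex t (Finset.mem_insert_of_mem ht)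
    have hMt : ¬ v M ≤ v t := (hlt t ht).not_ge
    rw [Finset.filter_insert, if_pos hMt, Finset.sum_insert (by simp [hM])] at hi
    rw [Finset.filter_insert, if_neg hMt] at hia
    set J := ∑ u ∈ S with ¬ v u ≤ v t, k u with hJ
    have hsum : ∀ a, ∑ u ∈ S, k u * min (v u a) (v t a) = i a + J * v t a := by
      intro a
      rw [hia, hJ, Nat.cast_sum, Finset.sum_mul,
        ← Finset.sum_filter_add_sum_filter_not S (fun u => v u ≤ v t)]
      congr 1
      · refine Finset.sum_congr rfl fun u hu => ?_
        rw [min_eq_left ((Finset.mem_filter.mp hu).2 a)]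
      · refine Finset.sum_congr rfl fun u hu => ?_
        obtain ⟨hu, hn⟩ := Finset.mem_filter.mp hu
        rw [min_eq_right (((hchain u hu t ht).resolve_left hn) a)]
    -- The vertex monomial of `g * h` is a product of monomials of the factors. If `j₂ < k M`, the
    -- two weight bounds would add up to too much in a coordinate where `v t < v M`; so `j₂ = k M`,
    -- and the bound on `g` then forces `i₁ = i`.
    obtain ⟨i₁, i₂, j₁, j₂, hi12, hj12, h1, h2⟩ := exists_of_coeff_mul_ne_zero hi
    have e1 := hgw t ht i₁ j₁ h1
    have e2 := hhw i₂ j₂ h2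
    have hj2 : j₂ ≤ k M := hd ▸ le_natDegree_of_ne_zero fun h0 => h2 (by simp [h0])
    have ei : ∀ a, (i a : ℝ) = i₁ a + i₂ a := fun a => by rw [← hi12]; simp
    have ej : (j₁ : ℝ) + j₂ = k M + J := by exact_mod_cast hj12
    simp only [hsum] at e1
    obtain ⟨hle', b, hb⟩ := Pi.lt_def.mp (hlt t ht)
    have hj2' : j₂ = k M := by
      by_contra hne
      have h3 : (j₂ : ℝ) < k M := by exact_mod_cast lt_of_le_of_ne hj2 hne
      have h4 := e1 b
      have h5 := e2 b
      have h6 := ei b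
      have h7 : (j₁ : ℝ) = k M + J - j₂ := by linarith
      rw [h7] at h4
      nlinarith [mul_pos (sub_pos.mpr h3) (sub_pos.mpr hb)]
    subst hj2'
    have hj1 : j₁ = J := by omega
    refine ⟨i₁, hj1 ▸ h1, fun a => ?_⟩
    rw [← hia]
    have h4 := e1 a
    have h6 := ei a
    rw [hj1] at h4
    have : (0 : ℝ) ≤ i₂ a := Nat.cast_nonneg _
    linarith
  · obtain ⟨i, hi, hia⟩ := hf.vertex M (Finset.mem_insert_self _ _)
    have hall : ∀ t ∈ insert M S, v t ≤ v M := by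
      intro t ht
      rcases Finset.mem_insert.mp ht with rfl | ht
      · exact le_rfl
      · exact (hlt t ht).le
    rw [Finset.filter_false_of_mem fun t ht => not_not.mpr (hall t ht), Finset.sum_empty] at hi
    rw [Finset.filter_true_of_mem hall] at hia
    obtain ⟨i₁, i₂, j₁, j₂, hi12, hj12, h1, h2⟩ := exists_of_coeff_mul_ne_zero hi
    obtain rfl : j₁ = 0 := by omega
    obtain rfl : j₂ = 0 := by omega
    -- The lower bounds for `i₁` and `i₂` add up to exactly `i`, so both are equalities.
    refine ⟨i₂, h2, fun a => ?_⟩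
    have e1 := hgw s hs i₁ 0 h1 a
    have e2 := hhw i₂ 0 h2 a
    have ei : (i a : ℝ) = i₁ a + i₂ a := by rw [← hi12]; simp
    have hmin : ∑ u ∈ S, k u * min (v u a) (v s a) = ∑ u ∈ S, k u * v u a :=
      Finset.sum_congr rfl fun u hu => by rw [min_eq_left (hmax u hu a)]
    have e3 := hia a
    rw [Finset.sum_insert hM] at e3
    simp only [hmin, Nat.cast_zero, zero_mul, add_zero] at e1 e2
    linarith

/-- On a chain the coordinate sum detects the order, so induction on its maximum removes the largest
slope each time. -/
theorem exists_factorization_of_slopes [Fintype σ] (v : ι → σ → ℝ) (k : ι → ℕ)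
    (hv : ∀ t a, 0 ≤ v t a) (S : Finset ι)
    (hchain : ∀ s ∈ S, ∀ t ∈ S, v s ≤ v t ∨ v t ≤ v s) (hinj : Set.InjOn v S)
    {f : (MvPowerSeries σ K)[X]} (hf : HasSlopes S v k f) :
    ∃ g : ι → (MvPowerSeries σ K)[X], f = ∏ t ∈ S, g t ∧ ∀ t ∈ S, HasSlope (v t) (k t) (g t) := by
  classical
  induction S using Finset.induction_on_max_value (fun t => ∑ a, v t a) generalizing f with
  | empty =>
    refine ⟨fun _ => 1, ?_, by simp⟩
    have := hf.natDegree_eq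
    rw [Finset.sum_empty] at this
    simpa using eq_one_of_monic_natDegree_zero hf.monic this
  | insert M S hM hmax ih =>
    have hle_of : ∀ s ∈ insert M S, ∀ t ∈ insert M S, ∑ a, v s a ≤ ∑ a, v t a → v s ≤ v t := by
      intro s hs t ht hst
      rcases hchain s hs t ht with h | h
      · exact h
      · have heq : ∑ a, v t a = ∑ a, v s a :=
          le_antisymm (Finset.sum_le_sum fun a _ => h a) hst
        have := (Finset.sum_eq_sum_iff_of_le fun a _ => h a).mp heq
        intro a
        exact (this a (Finset.mem_univ a)).ge
    -- A single slope is handled separately, as `split` needs a next slope to compare with.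
    rcases S.eq_empty_or_nonempty with rfl | hne
    · refine ⟨fun _ => f, by simp, ?_⟩
      intro t ht
      rw [insert_empty_eq, Finset.mem_singleton] at ht
      subst ht
      obtain ⟨i, hi, hia⟩ := hf.vertex t (by simp)
      refine ⟨hf.monic, by simpa using hf.natDegree_eq, ?_, i, ?_, ?_⟩
      · simpa using hf.weight t (by simp)
      · simpa [Finset.filter_singleton] using hi
      · simpa [Finset.filter_singleton] using hia
    · obtain ⟨s, hs, hsmax⟩ := S.exists_max_image (fun t => ∑ a, v t a) hne
      have hlt : ∀ t ∈ S, v t < v M := by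
        intro t ht
        refine lt_of_le_of_ne (hle_of t (Finset.mem_insert_of_mem ht) M
          (Finset.mem_insert_self _ _) (hmax t ht)) fun h => hM ?_
        rwa [← hinj (Finset.mem_insert_of_mem ht) (Finset.mem_insert_self _ _) h]
      obtain ⟨p, h, rfl, hp, hh⟩ := hf.split hv hM hlt hs (fun t ht =>
        hle_of t (Finset.mem_insert_of_mem ht) s (Finset.mem_insert_of_mem hs) (hsmax t ht))
        fun s hs t ht => hchain s (Finset.mem_insert_of_mem hs) t (Finset.mem_insert_of_mem ht)
      obtain ⟨g, hg, hg'⟩ := ih (fun s hs t ht => hchain s (Finset.mem_insert_of_mem hs) t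
        (Finset.mem_insert_of_mem ht)) (hinj.mono (by simp)) hp
      refine ⟨Function.update g M h, ?_, ?_⟩
      · rw [Finset.prod_insert hM, Function.update_self, mul_comm, hg]
        congr 1
        refine Finset.prod_congr rfl fun t ht => ?_
        rw [Function.update_of_ne (ne_of_mem_of_not_mem ht hM)]
      · intro t ht
        rcases Finset.mem_insert.mp ht with rfl | ht
        · rwa [Function.update_self]
        · rw [Function.update_of_ne (ne_of_mem_of_not_mem ht hM)]
          exact hg' t ht

end Slopes

/-! ### Elementary polytopes, and comparability of inclinations from polygonality. -/

section Polytope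

variable {d : ℕ}

theorem mem_elementary_coe {q : Fin d → ℚ≥0} {k : ℕ} {p : (Fin d → ℝ) × ℝ} :
    p ∈ elementary (q : WithTop (Fin d → ℚ≥0)) k ↔
      ∃ x ∈ Set.Icc (0 : ℝ) 1, (∀ a, x * ((q a : ℚ) : ℝ) ≤ p.1 a) ∧ (1 - x) * k ≤ p.2 := by
  change p ∈ convexHull ℝ _ ↔ _
  rw [convexHull_add, (convex_Ici _).convexHull_eq, convexHull_pair, Set.mem_add]
  constructor
  · rintro ⟨y, ⟨x, z, hx, hz, hxz, rfl⟩, o, ho, rfl⟩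
    obtain ⟨h1, h2⟩ := Prod.le_def.mp (Set.mem_Ici.mp ho)
    refine ⟨x, ⟨hx, by linarith⟩, fun a => ?_, ?_⟩
    · have := h1 a
      simp at this ⊢
      linarith
    · obtain rfl : z = 1 - x := by linarith
      simp at h2 ⊢
      linarith
  · rintro ⟨x, ⟨hx0, hx1⟩, h1, h2⟩
    refine ⟨_, ⟨x, 1 - x, hx0, by linarith, by ring, rfl⟩, _, ?_, add_sub_cancel _ _⟩
    rw [Set.mem_Ici, sub_nonneg, Prod.le_def]
    refine ⟨fun a => ?_, ?_⟩
    · simpa using h1 a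
    · simpa using h2

theorem mem_elementary_top {k : ℕ} {p : (Fin d → ℝ) × ℝ} :
    p ∈ elementary (⊤ : WithTop (Fin d → ℚ≥0)) k ↔ (∀ a, 0 ≤ p.1 a) ∧ (k : ℝ) ≤ p.2 := by
  change p ∈ {_} + Set.Ici _ ↔ _
  rw [Set.singleton_add, Set.mem_image]
  constructor
  · rintro ⟨o, ho, rfl⟩
    obtain ⟨h1, h2⟩ := Prod.le_def.mp (Set.mem_Ici.mp ho)
    exact ⟨fun a => by simpa using h1 a, by simpa using h2⟩
  · rintro ⟨h1, h2⟩
    refine ⟨_, ?_, add_sub_cancel _ _⟩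
    rw [Set.mem_Ici, sub_nonneg, Prod.le_def]
    exact ⟨fun a => by simpa using h1 a, by simpa using h2⟩

theorem vertex_mem_elementary (q : WithTop (Fin d → ℚ≥0)) (k : ℕ) :
    ((0 : Fin d → ℝ), (k : ℝ)) ∈ elementary q k := by
  induction q using WithTop.recTopCoe with
  | top => rw [mem_elementary_top]; simp
  | coe q => rw [mem_elementary_coe]; exact ⟨0, by simp⟩

theorem vertex_mem_elementary_coe (q : Fin d → ℚ≥0) (k : ℕ) :
    ((fun a => ((q a : ℚ) : ℝ)), (0 : ℝ)) ∈ elementary (q : WithTop (Fin d → ℚ≥0)) k := by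
  rw [mem_elementary_coe]; exact ⟨1, by simp⟩

theorem nonneg_of_mem_elementary {q : WithTop (Fin d → ℚ≥0)} {k : ℕ} {p : (Fin d → ℝ) × ℝ}
    (hp : p ∈ elementary q k) : 0 ≤ p := by
  induction q using WithTop.recTopCoe with
  | top =>
    rw [mem_elementary_top] at hp
    exact ⟨hp.1, (Nat.cast_nonneg k).trans hp.2⟩
  | coe q =>
    rw [mem_elementary_coe] at hp
    obtain ⟨x, ⟨hx0, hx1⟩, h1, h2⟩ := hp
    refine ⟨fun a => le_trans ?_ (h1 a), le_trans ?_ h2⟩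
    · have : (0 : ℝ) ≤ ((q a : ℚ) : ℝ) := by positivity
      exact mul_nonneg hx0 this
    · exact mul_nonneg (by linarith) (Nat.cast_nonneg _)

/-- Elementary polytopes are sums of a compact set and the positive orthant. -/
theorem exists_isCompact_elementary (q : WithTop (Fin d → ℚ≥0)) (k : ℕ) :
    ∃ C : Set ((Fin d → ℝ) × ℝ), IsCompact C ∧ elementary q k = C + Set.Ici 0 := by
  induction q using WithTop.recTopCoe with
  | top => exact ⟨_, isCompact_singleton, rfl⟩
  | coe q =>
    refine ⟨convexHull ℝ {((fun a => ((q a : ℚ) : ℝ)), (0 : ℝ)), ((0 : Fin d → ℝ), (k : ℝ))},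
      (Set.toFinite _).isCompact_convexHull ℝ, ?_⟩
    change convexHull ℝ _ = _
    rw [convexHull_add, (convex_Ici _).convexHull_eq]

/-- Closed sets need not have a closed sum, but here each term is a compact set plus the same closed
cone, which absorbs itself. An empty sum would lack the cone. -/
theorem isClosed_sum_elementary {ι : Type*} {T : Finset ι} (hT : T.Nonempty)
    (q : ι → WithTop (Fin d → ℚ≥0)) (k : ι → ℕ) :
    IsClosed (∑ t ∈ T, elementary (q t) (k t)) := by
  have hI : (Set.Ici 0 + Set.Ici 0 : Set ((Fin d → ℝ) × ℝ)) = Set.Ici 0 := by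
    ext x
    simp only [Set.mem_add, Set.mem_Ici]
    exact ⟨by rintro ⟨a, ha, b, hb, rfl⟩; exact add_nonneg ha hb,
      fun hx => ⟨0, le_rfl, x, hx, zero_add x⟩⟩
  suffices ∃ C : Set ((Fin d → ℝ) × ℝ), IsCompact C ∧
      ∑ t ∈ T, elementary (q t) (k t) = C + Set.Ici 0 by
    obtain ⟨C, hC, e⟩ := this
    rw [e]
    exact isClosed_Ici.add_left_of_isCompact hC
  induction hT using Finset.Nonempty.cons_induction with
  | singleton t => simpa using exists_isCompact_elementary (q t) (k t)
  | cons t T ht hT ih =>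
    obtain ⟨C, hC, e⟩ := ih
    obtain ⟨C', hC', e'⟩ := exists_isCompact_elementary (q t) (k t)
    refine ⟨C' + C, hC'.add hC, ?_⟩
    rw [Finset.sum_cons, e, e', add_add_add_comm, hI]

/-- The linear form `(x, y) ↦ w · x + l y`. -/
noncomputable def pairing (w : Fin d → ℝ) (l : ℝ) : StrongDual ℝ ((Fin d → ℝ) × ℝ) :=
  ∑ a, w a • (ContinuousLinearMap.proj a).comp (ContinuousLinearMap.fst ℝ (Fin d → ℝ) ℝ) +
    l • ContinuousLinearMap.snd ℝ (Fin d → ℝ) ℝ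

theorem pairing_apply (w : Fin d → ℝ) (l : ℝ) (p : (Fin d → ℝ) × ℝ) :
    pairing w l p = ∑ a, w a * p.1 a + l * p.2 := by
  simp [pairing]

theorem pairing_mono {w : Fin d → ℝ} {l : ℝ} (hw : ∀ a, 0 ≤ w a) (hl : 0 ≤ l)
    {p p' : (Fin d → ℝ) × ℝ} (h : p ≤ p') : pairing w l p ≤ pairing w l p' := by
  rw [pairing_apply, pairing_apply]
  exact add_le_add (Finset.sum_le_sum fun a _ => mul_le_mul_of_nonneg_left (h.1 a) (hw a))
    (mul_le_mul_of_nonneg_left h.2 hl)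

/-- Strict positivity of the coefficients is what makes minimizers unique later on. -/
theorem eq_of_le_of_pairing_le {w : Fin d → ℝ} {l : ℝ} (hw : ∀ a, 0 < w a) (hl : 0 < l)
    {p p' : (Fin d → ℝ) × ℝ} (h : p ≤ p') (h' : pairing w l p' ≤ pairing w l p) : p' = p := by
  rw [pairing_apply, pairing_apply] at h'
  have h1 : ∀ a ∈ Finset.univ, w a * p.1 a ≤ w a * p'.1 a :=
    fun a _ => mul_le_mul_of_nonneg_left (h.1 a) (hw a).le
  have h2 : l * p.2 ≤ l * p'.2 := mul_le_mul_of_nonneg_left h.2 hl.le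
  have h3 := Finset.sum_le_sum h1
  have h4 := (Finset.sum_eq_sum_iff_of_le h1).mp (by linarith)
  refine Prod.ext (funext fun a => ?_) ?_
  · exact (mul_left_cancel₀ (hw a).ne' (h4 a (Finset.mem_univ a))).symm
  · exact mul_left_cancel₀ hl.ne' (by linarith)

/-- The minimum of a nonnegative linear form on `{q / k}` is attained at one of the vertices. -/
theorem le_pairing_of_mem_elementary {w : Fin d → ℝ} {l : ℝ} (hw : ∀ a, 0 ≤ w a) (hl : 0 ≤ l)
    {q : Fin d → ℚ≥0} {k : ℕ} {p : (Fin d → ℝ) × ℝ}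
    (hp : p ∈ elementary (q : WithTop (Fin d → ℚ≥0)) k) :
    ∃ x ∈ Set.Icc (0 : ℝ) 1,
      x * (∑ a, w a * ((q a : ℚ) : ℝ)) + (1 - x) * (l * k) ≤ pairing w l p := by
  obtain ⟨x, hx, h1, h2⟩ := mem_elementary_coe.mp hp
  refine ⟨x, hx, ?_⟩
  have := pairing_mono (p := (fun a => x * ((q a : ℚ) : ℝ), (1 - x) * k)) hw hl ⟨h1, h2⟩
  refine le_trans (le_of_eq ?_) this
  rw [pairing_apply, Finset.mul_sum]
  congr 1
  · exact Finset.sum_congr rfl fun a _ => by ring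
  · ring

theorem exists_isMinOn_elementary {w : Fin d → ℝ} {l : ℝ} (hw : ∀ a, 0 ≤ w a) (hl : 0 ≤ l)
    (q : WithTop (Fin d → ℚ≥0)) (k : ℕ) :
    ∃ e ∈ elementary q k, ∀ p ∈ elementary q k, pairing w l e ≤ pairing w l p := by
  induction q using WithTop.recTopCoe with
  | top =>
    refine ⟨_, vertex_mem_elementary ⊤ k, fun p hp => pairing_mono hw hl ?_⟩
    exact mem_elementary_top.mp hp
  | coe q =>
    rcases le_total (∑ a, w a * ((q a : ℚ) : ℝ)) (l * k) with h | h
    · refine ⟨_, vertex_mem_elementary_coe q k, fun p hp => ?_⟩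
      obtain ⟨x, ⟨hx0, hx1⟩, hx⟩ := le_pairing_of_mem_elementary hw hl hp
      rw [pairing_apply]
      simp only [mul_zero, add_zero]
      nlinarith
    · refine ⟨_, vertex_mem_elementary _ k, fun p hp => ?_⟩
      obtain ⟨x, ⟨hx0, hx1⟩, hx⟩ := le_pairing_of_mem_elementary hw hl hp
      rw [pairing_apply]
      simp only [Pi.zero_apply, mul_zero, Finset.sum_const_zero, zero_add]
      nlinarith

/-- Incomparable inclinations produce a compact face of dimension at least two. -/
theorem comparable_of_isPolygonal {ι : Type*} [Fintype ι] {q : ι → WithTop (Fin d → ℚ≥0)}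
    {k : ι → ℕ} (hk : ∀ t, 0 < k t) (hP : IsPolygonal (∑ t, elementary (q t) (k t)))
    {s t : ι} {u u' : Fin d → ℚ≥0} (hs : q s = u) (ht : q t = u') :
    (∀ a, ((u a : ℚ) : ℝ) / k s ≤ ((u' a : ℚ) : ℝ) / k t) ∨
      ∀ a, ((u' a : ℚ) : ℝ) / k t ≤ ((u a : ℚ) : ℝ) / k s := by
  classical
  by_contra! hcon
  obtain ⟨⟨a₀, ha₀⟩, b₀, hb₀⟩ := hcon
  have hks : (0 : ℝ) < k s := by exact_mod_cast hk s
  have hkt : (0 : ℝ) < k t := by exact_mod_cast hk t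
  set z : Fin d → ℝ := fun a => ((u a : ℚ) : ℝ) / k s - ((u' a : ℚ) : ℝ) / k t with hz
  have hza : 0 < z a₀ := sub_pos.mpr ha₀
  have hzb : z b₀ < 0 := sub_neg.mpr hb₀
  -- As `z` takes both signs, weighting its positive entries by the total `B` of the negative part
  -- and the others by the total `A` of the positive part balances the sum.
  obtain ⟨w, hw, hwz⟩ : ∃ w : Fin d → ℝ, (∀ a, 0 < w a) ∧ ∑ a, w a * z a = 0 := by
    set A := ∑ a, max (z a) 0 with hA
    set B := ∑ a, max (-z a) 0 with hB
    have hApos : 0 < A := Finset.sum_pos' (fun a _ => le_max_right _ _)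
      ⟨a₀, Finset.mem_univ _, lt_max_of_lt_left hza⟩
    have hBpos : 0 < B := Finset.sum_pos' (fun a _ => le_max_right _ _)
      ⟨b₀, Finset.mem_univ _, lt_max_of_lt_left (by linarith)⟩
    refine ⟨fun a => if 0 < z a then B else A, fun a => by dsimp only; split_ifs <;> assumption, ?_⟩
    have : ∀ a, (if 0 < z a then B else A) * z a = B * max (z a) 0 - A * max (-z a) 0 := by
      intro a
      split_ifs with h
      · rw [max_eq_left h.le, max_eq_right (by linarith)]; ring
      · rw [max_eq_right (not_lt.mp h), max_eq_left (by linarith [not_lt.mp h])]; ring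
    rw [Finset.sum_congr rfl fun a _ => this a, Finset.sum_sub_distrib, ← Finset.mul_sum,
      ← Finset.mul_sum, ← hA, ← hB]
    ring
  have hu0 : ∀ a, (0 : ℝ) ≤ ((u a : ℚ) : ℝ) := fun a => by positivity
  -- With this `l` the form is constant on the edge of the `s`-th term, and by the choice of `w`
  -- also on that of the `t`-th.
  set l := ∑ a, w a * (((u a : ℚ) : ℝ) / k s) with hl
  have hl' : l = ∑ a, w a * (((u' a : ℚ) : ℝ) / k t) := by
    rw [← sub_eq_zero, hl, ← Finset.sum_sub_distrib, ← hwz]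
    exact Finset.sum_congr rfl fun a _ => by rw [hz]; ring
  have hu0' : ∀ a, (0 : ℝ) ≤ ((u' a : ℚ) : ℝ) := fun a => by positivity
  have hlpos : 0 < l := by
    refine Finset.sum_pos' (fun a _ => mul_nonneg (hw a).le (div_nonneg (hu0 a) hks.le))
      ⟨a₀, Finset.mem_univ _, mul_pos (hw a₀) ?_⟩
    exact lt_of_le_of_lt (div_nonneg (hu0' a₀) hkt.le) ha₀
  have hls : ∑ a, w a * ((u a : ℚ) : ℝ) = l * k s := by
    rw [hl, Finset.sum_mul]
    exact Finset.sum_congr rfl fun a _ => by field_simp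
  have hlt : ∑ a, w a * ((u' a : ℚ) : ℝ) = l * k t := by
    rw [hl', Finset.sum_mul]
    exact Finset.sum_congr rfl fun a _ => by field_simp
  set P := ∑ t, elementary (q t) (k t) with hPdef
  have hclosed : IsClosed P := isClosed_sum_elementary ⟨s, Finset.mem_univ s⟩ q k
  choose e he hemin using fun t =>
    exists_isMinOn_elementary (l := l) (fun a => (hw a).le) hlpos.le (q t) (k t)
  set F := {x ∈ P | ∀ y ∈ P, pairing w l x ≤ pairing w l y} with hF
  have hsumF : ∀ p : ι → (Fin d → ℝ) × ℝ, (∀ t, p t ∈ elementary (q t) (k t)) →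
      (∀ t, pairing w l (p t) ≤ pairing w l (e t)) → ∑ t, p t ∈ F := by
    intro p hp hpe
    refine ⟨Set.finsetSum_mem_finsetSum _ _ _ fun t _ => hp t, fun y hy => ?_⟩
    obtain ⟨y, hy', rfl⟩ := (Set.mem_finsetSum _ _ _).mp hy
    rw [map_sum, map_sum]
    exact Finset.sum_le_sum fun t ht => (hpe t).trans (hemin t _ (hy' (Finset.mem_univ t)))
  have hne : F.Nonempty := ⟨_, hsumF e he fun t => le_rfl⟩
  have hexp : IsExposed ℝ P F := by
    intro _
    -- Exposed faces are defined by maximizing, hence the sign.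
    refine ⟨-pairing w l, ?_⟩
    simp [hF]
  have hnonneg : ∀ x ∈ P, 0 ≤ x := by
    intro x hx
    obtain ⟨y, hy, rfl⟩ := (Set.mem_finsetSum _ _ _).mp hx
    exact Finset.sum_nonneg fun t ht => nonneg_of_mem_elementary (hy ht)
  -- The polytope lies in the positive orthant and all coefficients of the form are positive, so its
  -- level sets there are bounded.
  have hcompact : IsCompact F := by
    obtain ⟨x₀, hx₀⟩ := hne
    refine IsCompact.of_isClosed_subset
      (isCompact_Icc (a := (0 : (Fin d → ℝ) × ℝ))
        (b := (fun a => pairing w l x₀ / w a, pairing w l x₀ / l))) ?_ ?_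
    · have : F = P ∩ {x | pairing w l x ≤ pairing w l x₀} := by
        ext x
        exact ⟨fun hx => ⟨hx.1, hx.2 _ hx₀.1⟩, fun hx => ⟨hx.1, fun y hy =>
          le_trans hx.2 (hx₀.2 y hy)⟩⟩
      rw [this]
      exact hclosed.inter (isClosed_le (pairing w l).continuous continuous_const)
    · intro x hx
      have h0 := hnonneg x hx.1
      have h1 := hx.2 _ hx₀.1
      rw [pairing_apply] at h1
      have h2 : ∀ a ∈ Finset.univ, 0 ≤ w a * x.1 a := fun a _ => mul_nonneg (hw a).le (h0.1 a)
      have h3 : 0 ≤ l * x.2 := mul_nonneg hlpos.le h0.2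
      refine ⟨h0, fun a => ?_, ?_⟩
      · change x.1 a ≤ _ / _
        rw [le_div_iff₀ (hw a)]
        have := Finset.single_le_sum h2 (Finset.mem_univ a)
        linarith
      · change x.2 ≤ _ / _
        rw [le_div_iff₀ hlpos]
        have := Finset.sum_nonneg h2
        linarith
  -- Keeping the minimizers of the other terms and moving the `r`-th from one end of its edge to the
  -- other stays in `F`.
  have hspan : ∀ (r : ι) (c : Fin d → ℚ≥0), q r = c → ∑ a, w a * ((c a : ℚ) : ℝ) = l * k r →
      ((fun a => ((c a : ℚ) : ℝ), (0 : ℝ)) - ((0 : Fin d → ℝ), (k r : ℝ))) ∈ vectorSpan ℝ F := by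
    intro r c hr hc
    have hmin : ∀ p ∈ elementary (q r) (k r), l * k r ≤ pairing w l p := by
      intro p hp
      rw [hr] at hp
      obtain ⟨x, hx, hxp⟩ := le_pairing_of_mem_elementary (fun a => (hw a).le) hlpos.le hp
      rw [hc] at hxp
      linarith
    have key : ∀ p ∈ elementary (q r) (k r), pairing w l p = l * k r →
        ∑ t, Function.update e r p t ∈ F := by
      intro p hp hpe
      refine hsumF _ (fun t => ?_) fun t => ?_
      · rcases eq_or_ne t r with rfl | h
        · rwa [Function.update_self]
        · rw [Function.update_of_ne h]; exact he t
      · rcases eq_or_ne t r with rfl | h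
        · rw [Function.update_self, hpe]; exact hmin _ (he t)
        · rw [Function.update_of_ne h]
    have := vsub_mem_vectorSpan ℝ
      (key _ (by rw [hr]; exact vertex_mem_elementary_coe c (k r)) (by
        rw [pairing_apply]; simpa using hc))
      (key _ (vertex_mem_elementary (q r) (k r)) (by rw [pairing_apply]; simp))
    rw [Finset.sum_update_of_mem (Finset.mem_univ r), Finset.sum_update_of_mem (Finset.mem_univ r),
      vsub_eq_sub, add_sub_add_right_eq_sub] at this
    exact this
  -- In dimension one the two edge directions are proportional, so the inclinations would agree at
  -- `a₀`.
  have hrank : Module.finrank ℝ (vectorSpan ℝ F) ≤ 1 := hP.2 ⟨F, hexp, hne, hcompact, rfl⟩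
  obtain ⟨x, hx⟩ := finrank_le_one_iff.mp hrank
  obtain ⟨c, hc⟩ := hx ⟨_, hspan s u hs hls⟩
  obtain ⟨c', hc'⟩ := hx ⟨_, hspan t u' ht hlt⟩
  have h1 : c * (x : (Fin d → ℝ) × ℝ).1 a₀ = ((u a₀ : ℚ) : ℝ) := by
    simpa using congrArg (fun y : vectorSpan ℝ F => (y : (Fin d → ℝ) × ℝ).1 a₀) hc
  have h2 : c * (x : (Fin d → ℝ) × ℝ).2 = -(k s : ℝ) := by
    simpa using congrArg (fun y : vectorSpan ℝ F => (y : (Fin d → ℝ) × ℝ).2) hc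
  have h3 : c' * (x : (Fin d → ℝ) × ℝ).1 a₀ = ((u' a₀ : ℚ) : ℝ) := by
    simpa using congrArg (fun y : vectorSpan ℝ F => (y : (Fin d → ℝ) × ℝ).1 a₀) hc'
  have h4 : c' * (x : (Fin d → ℝ) × ℝ).2 = -(k t : ℝ) := by
    simpa using congrArg (fun y : vectorSpan ℝ F => (y : (Fin d → ℝ) × ℝ).2) hc'
  rw [div_lt_div_iff₀ hkt hks] at ha₀
  have h2' : (k s : ℝ) = -(c * (x : (Fin d → ℝ) × ℝ).2) := by linarith
  have h4' : (k t : ℝ) = -(c' * (x : (Fin d → ℝ) × ℝ).2) := by linarith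
  rw [← h1, ← h3, h2', h4'] at ha₀
  linarith

end Polytope

/-! ### From polytopes to monomials and back. -/

section Support

variable {K : Type*} [Field K] {d : ℕ} {f : (MvPowerSeries (Fin d) K)[X]}

theorem mem_newtonPolytope_of_le {i : Fin d →₀ ℕ} {j : ℕ}
    (h : MvPowerSeries.coeff i (f.coeff j) ≠ 0) {p : (Fin d → ℝ) × ℝ}
    (hp : ((fun a => (i a : ℝ)), (j : ℝ)) ≤ p) : p ∈ newtonPolytope f := by
  refine subset_convexHull ℝ _ ?_
  simp only [Set.mem_iUnion]
  exact ⟨i, j, h, _, rfl, p - _, sub_nonneg.mpr hp, add_sub_cancel _ _⟩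

theorem newtonPolytope_subset {E : Set ((Fin d → ℝ) × ℝ)} (hE : Convex ℝ E)
    (h : ∀ i j, MvPowerSeries.coeff i (f.coeff j) ≠ 0 →
      ∀ p, ((fun a => (i a : ℝ)), (j : ℝ)) ≤ p → p ∈ E) : newtonPolytope f ⊆ E := by
  refine convexHull_min ?_ hE
  simp only [Set.iUnion_subset_iff]
  rintro i j hij _ ⟨_, rfl, o, ho, rfl⟩
  exact h i j hij _ (le_add_of_nonneg_right ho)

/-- Otherwise the whole polytope would lie in an open half-space that omits `p`. -/
theorem exists_support_le {w : Fin d → ℝ} {l : ℝ} (hw : ∀ a, 0 ≤ w a) (hl : 0 ≤ l)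
    {p : (Fin d → ℝ) × ℝ} (hp : p ∈ newtonPolytope f) :
    ∃ i j, MvPowerSeries.coeff i (f.coeff j) ≠ 0 ∧
      pairing w l ((fun a => (i a : ℝ)), (j : ℝ)) ≤ pairing w l p := by
  by_contra! hcon
  have : newtonPolytope f ⊆ {x | pairing w l p < pairing w l x} :=
    newtonPolytope_subset (convex_halfSpace_gt (pairing w l).toLinearMap.isLinear _)
      fun i j hij x hx => (hcon i j hij).trans_le (pairing_mono hw hl hx)
  exact (lt_irrefl (pairing w l p)) (this hp)

theorem convex_elementary (q : WithTop (Fin d → ℚ≥0)) (k : ℕ) : Convex ℝ (elementary q k) := by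
  induction q using WithTop.recTopCoe with
  | top => exact (convex_singleton _).add (convex_Ici _)
  | coe q => exact convex_convexHull ℝ _

theorem newtonPolytope_X_pow (k : ℕ) :
    newtonPolytope (X ^ k : (MvPowerSeries (Fin d) K)[X]) = elementary ⊤ k := by
  classical
  apply Set.Subset.antisymm
  · refine newtonPolytope_subset (convex_elementary _ _) fun i j hij p hp => ?_
    rw [coeff_X_pow] at hij
    split_ifs at hij with h
    · subst h
      rw [mem_elementary_top]
      exact ⟨fun a => (Nat.cast_nonneg _).trans (hp.1 a), hp.2⟩
    · simp at hij
  · intro p hp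
    rw [mem_elementary_top] at hp
    refine mem_newtonPolytope_of_le (i := 0) (j := k) (by simp) ⟨fun a => ?_, hp.2⟩
    simpa using hp.1 a

theorem newtonPolytope_one (k : ℕ) :
    newtonPolytope (1 : (MvPowerSeries (Fin d) K)[X]) = elementary ((0 : Fin d → ℚ≥0) :) k := by
  classical
  apply Set.Subset.antisymm
  · refine newtonPolytope_subset (convex_elementary _ _) fun i j hij p hp => ?_
    rw [mem_elementary_coe]
    refine ⟨1, by simp, fun a => ?_, ?_⟩
    · simpa using (Nat.cast_nonneg _).trans (hp.1 a)
    · simpa using (Nat.cast_nonneg _).trans hp.2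
  · intro p hp
    have := nonneg_of_mem_elementary hp
    refine mem_newtonPolytope_of_le (i := 0) (j := 0) (by simp) ⟨fun a => ?_, ?_⟩
    · simpa using this.1 a
    · simpa using this.2

/-- The weight bound puts all monomials above the segment; its ends are the monomial from `vertex`
and the leading `y^k`. -/
theorem HasSlope.newtonPolytope_eq {q : Fin d → ℚ≥0} {k : ℕ} (hk : 0 < k)
    (hf : HasSlope (fun a => ((q a : ℚ) : ℝ) / k) k f) :
    newtonPolytope f = elementary (q : WithTop (Fin d → ℚ≥0)) k := by
  classical
  have hk' : (0 : ℝ) < k := by exact_mod_cast hk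
  have hkq : ∀ a, (k : ℝ) * (((q a : ℚ) : ℝ) / k) = ((q a : ℚ) : ℝ) :=
    fun a => mul_div_cancel₀ _ hk'.ne'
  have hq0 : ∀ a, (0 : ℝ) ≤ ((q a : ℚ) : ℝ) := fun a => by positivity
  apply Set.Subset.antisymm
  · refine newtonPolytope_subset (convex_elementary _ _) fun i j hij p hp => ?_
    rw [mem_elementary_coe]
    have hj : j ≤ k := hf.natDegree_eq ▸ le_natDegree_of_ne_zero fun h0 => hij (by simp [h0])
    have hj' : (j : ℝ) / k ≤ 1 := by
      rw [div_le_one hk']; exact_mod_cast hj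
    refine ⟨1 - j / k, ⟨by linarith, by
      have : (0 : ℝ) ≤ j / k := by positivity
      linarith⟩, fun a => ?_, ?_⟩
    · have h1 := hf.weight i j hij a
      simp only [hkq] at h1
      have h2 : (i a : ℝ) ≤ p.1 a := hp.1 a
      have h3 : (1 - (j : ℝ) / k) * ((q a : ℚ) : ℝ) =
          ((q a : ℚ) : ℝ) - j * (((q a : ℚ) : ℝ) / k) := by ring
      rw [h3]
      linarith
    · rw [sub_sub_cancel, div_mul_cancel₀ _ hk'.ne']
      exact hp.2
  · intro p hp
    obtain ⟨x, ⟨hx0, hx1⟩, h1, h2⟩ := mem_elementary_coe.mp hp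
    obtain ⟨i, hi, hia⟩ := hf.vertex
    -- Translating both ends of the segment by the excess `o` makes `p` a convex combination of
    -- points above monomials.
    set o : (Fin d → ℝ) × ℝ := p - (fun a => x * ((q a : ℚ) : ℝ), (1 - x) * k) with ho
    have ho0 : 0 ≤ o := sub_nonneg.mpr ⟨h1, h2⟩
    have e : x • (((fun a => ((q a : ℚ) : ℝ)), (0 : ℝ)) + o) +
        (1 - x) • (((0 : Fin d → ℝ), (k : ℝ)) + o) = p := by
      refine Prod.ext (funext fun a => ?_) ?_
      · simp [ho]; ring
      · simp [ho]; ring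
    rw [← e]
    refine convex_convexHull ℝ _ ?_ ?_ hx0 (sub_nonneg.mpr hx1) (by ring)
    · refine mem_newtonPolytope_of_le hi (le_add_of_le_of_nonneg ⟨fun a => ?_, ?_⟩ ho0)
      · exact (hia a).le.trans (hkq a).le
      · simp
    · refine mem_newtonPolytope_of_le (i := 0) (j := k) ?_
        (le_add_of_le_of_nonneg ⟨fun a => ?_, le_rfl⟩ ho0)
      · have := hf.monic.coeff_natDegree
        rw [hf.natDegree_eq] at this
        rw [this]
        simp
      · simp

theorem not_isUnit_of_coeff_zero {φ : MvPowerSeries (Fin d) K}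
    (h : MvPowerSeries.coeff 0 φ = 0) : ¬ IsUnit φ := by
  rw [MvPowerSeries.isUnit_iff_constantCoeff, ← MvPowerSeries.coeff_zero_eq_constantCoeff_apply, h]
  exact not_isUnit_zero

theorem HasSlope.isWeierstrass {v : Fin d → ℝ} {k : ℕ} {a : Fin d} (ha : 0 < v a)
    (hf : HasSlope v k f) : IsWeierstrass f := by
  refine ⟨hf.monic, fun j hj => not_isUnit_of_coeff_zero ?_⟩
  by_contra hne
  have h1 := hf.weight 0 j hne a
  rw [hf.natDegree_eq] at hj
  have : (j : ℝ) < k := by exact_mod_cast hj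
  simp only [Finsupp.coe_zero, Pi.zero_apply, Nat.cast_zero, zero_add] at h1
  nlinarith

/-- The vector `q` with real coordinates (and the junk value `0` at `∞`). -/
noncomputable def realVec (q : WithTop (Fin d → ℚ≥0)) (a : Fin d) : ℝ := ((q.untopD 0 a : ℚ) : ℝ)

theorem realVec_nonneg (q : WithTop (Fin d → ℚ≥0)) (a : Fin d) : 0 ≤ realVec q a := by
  unfold realVec; positivity

open Classical in
/-- The vertex of a sum of elementary polytopes cut out by a linear form in general position is
the exponent of a monomial. -/
theorem exists_support_vertex {ι : Type*} [Fintype ι] {q : ι → WithTop (Fin d → ℚ≥0)} {k : ι → ℕ}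
    (hf : newtonPolytope f = ∑ t, elementary (q t) (k t)) {l : ℝ} (hl : 0 < l)
    (hsep : ∀ t, q t = ⊤ ∨ ∑ a, realVec (q t) a < l * k t ∨ l * k t < ∑ a, realVec (q t) a) :
    ∃ i, MvPowerSeries.coeff i
        (f.coeff (∑ t with ¬ (q t ≠ ⊤ ∧ ∑ a, realVec (q t) a < l * k t), k t)) ≠ 0 ∧
      ∀ a, (i a : ℝ) = ∑ t with (q t ≠ ⊤ ∧ ∑ a, realVec (q t) a < l * k t), realVec (q t) a := by
  -- `V t` is the unique minimizer of `∑ x_a + l y` on the `t`-th term; `hsep` excludes ties.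
  set V : ι → (Fin d → ℝ) × ℝ := fun t =>
    if q t ≠ ⊤ ∧ ∑ a, realVec (q t) a < l * k t then (realVec (q t), 0) else (0, (k t : ℝ)) with hV
  have hmem : ∀ t, V t ∈ elementary (q t) (k t) := by
    intro t
    simp only [hV]
    split_ifs with h
    · obtain ⟨u, hu⟩ := WithTop.ne_top_iff_exists.mp h.1
      rw [← hu]
      exact vertex_mem_elementary_coe u (k t)
    · exact vertex_mem_elementary _ _
  have hmin : ∀ t, ∀ p ∈ elementary (q t) (k t),
      pairing 1 l (V t) ≤ pairing 1 l p ∧ (pairing 1 l p = pairing 1 l (V t) → p = V t) := by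
    intro t p hp
    by_cases hq : q t = ⊤
    · have hVt : V t = (0, (k t : ℝ)) := by simp [hV, hq]
      rw [hq, mem_elementary_top] at hp
      have hle : V t ≤ p := by rw [hVt]; exact hp
      exact ⟨pairing_mono (by simp) hl.le hle,
        fun h => eq_of_le_of_pairing_le (by simp) hl hle h.le⟩
    · obtain ⟨u, hu⟩ := WithTop.ne_top_iff_exists.mp hq
      have hr : ∀ a, realVec (q t) a = ((u a : ℚ) : ℝ) := fun a => by rw [← hu]; rfl
      have hs := (hsep t).resolve_left hq
      rw [← hu] at hp
      obtain ⟨x, ⟨hx0, hx1⟩, h1, h2⟩ := mem_elementary_coe.mp hp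
      have h3 := pairing_mono (w := 1) (p := (fun a => x * ((u a : ℚ) : ℝ), (1 - x) * k t))
        (fun _ => zero_le_one) hl.le ⟨h1, h2⟩
      have h4 : pairing 1 l ((fun a => x * ((u a : ℚ) : ℝ)), (1 - x) * k t) =
          x * (∑ a, realVec (q t) a) + (1 - x) * (l * k t) := by
        rw [pairing_apply, Finset.mul_sum]
        simp only [Pi.one_apply, one_mul, hr]
        ring
      rw [h4] at h3
      by_cases hc : ∑ a, realVec (q t) a < l * k t
      · have hVt : V t = (realVec (q t), 0) := by simp only [hV]; rw [if_pos ⟨hq, hc⟩]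
        have h5 : pairing 1 l (V t) = ∑ a, realVec (q t) a := by
          rw [hVt, pairing_apply]; simp
        rw [h5]
        refine ⟨by nlinarith, fun h => ?_⟩
        obtain rfl : x = 1 := by
          by_contra hne
          have : x < 1 := lt_of_le_of_ne hx1 hne
          nlinarith
        refine eq_of_le_of_pairing_le (w := 1) (by simp) hl ?_ (h.trans h5.symm).le
        rw [hVt]
        refine ⟨fun a => ?_, by simpa using h2⟩
        change realVec (q t) a ≤ _
        rw [hr]
        simpa using h1 a
      · have hVt : V t = (0, (k t : ℝ)) := by simp only [hV]; rw [if_neg fun h => hc h.2]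
        have hc := hs.resolve_left hc
        have h5 : pairing 1 l (V t) = l * k t := by
          rw [hVt, pairing_apply]; simp
        rw [h5]
        refine ⟨by nlinarith, fun h => ?_⟩
        obtain rfl : x = 0 := by
          by_contra hne
          have : 0 < x := lt_of_le_of_ne hx0 (Ne.symm hne)
          nlinarith
        refine eq_of_le_of_pairing_le (w := 1) (by simp) hl ?_ (h.trans h5.symm).le
        rw [hVt]
        refine ⟨fun a => by simpa using h1 a, by simpa using h2⟩
  have hVf : ∑ t, V t ∈ newtonPolytope f := by
    rw [hf]; exact Set.finsetSum_mem_finsetSum _ _ _ fun t _ => hmem t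
  obtain ⟨i, j, hij, hle⟩ := exists_support_le (w := 1) (fun _ => zero_le_one) hl.le hVf
  have hmem' := mem_newtonPolytope_of_le hij le_rfl
  rw [hf] at hmem'
  -- A monomial with value at most that of `∑ V t` decomposes into minimizers of the terms, so by
  -- uniqueness it is `∑ V t`.
  obtain ⟨p, hp, hsum⟩ := (Set.mem_finsetSum _ _ _).mp hmem'
  rw [← hsum, map_sum, map_sum] at hle
  have h1 : ∀ t ∈ Finset.univ, pairing 1 l (V t) ≤ pairing 1 l (p t) :=
    fun t ht => (hmin t _ (hp ht)).1
  have h2 := (Finset.sum_eq_sum_iff_of_le h1).mp (le_antisymm (Finset.sum_le_sum h1) hle)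
  have h3 : ∑ t, p t = ∑ t, V t := Finset.sum_congr rfl fun t ht =>
    (hmin t _ (hp ht)).2 (h2 t ht).symm
  rw [h3] at hsum
  have hj : j = ∑ t with ¬ (q t ≠ ⊤ ∧ ∑ a, realVec (q t) a < l * k t), k t := by
    have := congrArg Prod.snd hsum
    rw [Prod.snd_sum] at this
    change _ = (j : ℝ) at this
    have h : (j : ℝ) = ((∑ t with ¬ (q t ≠ ⊤ ∧ ∑ a, realVec (q t) a < l * k t), k t : ℕ) : ℝ) := by
      rw [← this, Nat.cast_sum, Finset.sum_filter]
      refine Finset.sum_congr rfl fun t _ => ?_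
      simp only [hV]
      split_ifs <;> simp_all
    exact_mod_cast h
  refine ⟨i, hj ▸ hij, fun a => ?_⟩
  have := congrFun (congrArg Prod.fst hsum) a
  rw [Prod.fst_sum, Finset.sum_apply] at this
  change _ = (i a : ℝ) at this
  rw [← this, Finset.sum_filter]
  refine Finset.sum_congr rfl fun t _ => ?_
  simp only [hV]
  split_ifs <;> simp

end Support

/-! ### Slope data from a sum of elementary polytopes. -/

section Representation

/-- Provides the general position: for this `l`, `n t < l` is equivalent to `n t ≤ μ`, and no `n t`
equals `l`. -/
theorem exists_gt_avoiding {ι : Type*} [Finite ι] (n : ι → ℝ) (μ : ℝ) :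
    ∃ l > μ, ∀ t, n t ≤ μ ∨ l < n t := by
  have h : ∀ᶠ l in nhdsWithin μ (Set.Ioi μ), ∀ t, n t ≤ μ ∨ l < n t := by
    refine Filter.eventually_all.mpr fun t => ?_
    rcases le_or_gt (n t) μ with h | h
    · exact Filter.Eventually.of_forall fun _ => Or.inl h
    · filter_upwards [Ioo_mem_nhdsGT h] with l hl using Or.inr hl.2
  obtain ⟨l, h1, h2⟩ := (h.and self_mem_nhdsWithin).exists
  exact ⟨l, h2, h1⟩

variable {K : Type*} [Field K] {d : ℕ} {ι : Type*} [Fintype ι] {f : (MvPowerSeries (Fin d) K)[X]}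
  {q : ι → WithTop (Fin d → ℚ≥0)} {k : ι → ℕ}

theorem realVec_coe (u : Fin d → ℚ≥0) (a : Fin d) :
    realVec (u : WithTop (Fin d → ℚ≥0)) a = ((u a : ℚ) : ℝ) := rfl

theorem realVec_zero : realVec (0 : WithTop (Fin d → ℚ≥0)) = 0 := by
  funext a
  change ((((0 : Fin d → ℚ≥0) a : ℚ≥0) : ℚ) : ℝ) = 0
  simp

theorem inclination_coe (u : Fin d → ℚ≥0) (k : ℕ) :
    inclination (u : WithTop (Fin d → ℚ≥0)) k =
      ((fun a => u a / (k : ℚ≥0) : Fin d → ℚ≥0) : WithTop (Fin d → ℚ≥0)) := rfl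

open Classical in
/-- Coordinatewise lower bound for the monomials of a polynomial with known Newton polytope. -/
theorem sum_min_le (hf : newtonPolytope f = ∑ t, elementary (q t) (k t)) {i : Fin d →₀ ℕ} {j : ℕ}
    (hij : MvPowerSeries.coeff i (f.coeff j) ≠ 0) (a : Fin d) {w : ℝ} (hw : 0 ≤ w) :
    (∑ t, if q t = ⊤ then k t * w else min (realVec (q t) a) (k t * w)) ≤ i a + j * w := by
  have hmem := mem_newtonPolytope_of_le hij le_rfl
  rw [hf] at hmem
  obtain ⟨p, hp, hsum⟩ := (Set.mem_finsetSum _ _ _).mp hmem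
  have h1 : ∑ t, (p t).1 a = i a := by
    have := congrFun (congrArg Prod.fst hsum) a
    rwa [Prod.fst_sum, Finset.sum_apply] at this
  have h2 : ∑ t, (p t).2 = j := by
    have := congrArg Prod.snd hsum
    rwa [Prod.snd_sum] at this
  rw [← h1, ← h2, Finset.sum_mul, ← Finset.sum_add_distrib]
  refine Finset.sum_le_sum fun t ht => ?_
  have hpt := hp ht
  split_ifs with h
  · rw [h, mem_elementary_top] at hpt
    have := mul_le_mul_of_nonneg_right hpt.2 hw
    linarith [hpt.1 a]
  · obtain ⟨u, hu⟩ := WithTop.ne_top_iff_exists.mp h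
    rw [← hu] at hpt ⊢
    rw [realVec_coe]
    obtain ⟨x, ⟨hx0, hx1⟩, h3, h4⟩ := mem_elementary_coe.mp hpt
    have h5 := mul_le_mul_of_nonneg_left (min_le_left (((u a : ℚ) : ℝ)) (k t * w)) hx0
    have h6 := mul_le_mul_of_nonneg_left (min_le_right (((u a : ℚ) : ℝ)) (k t * w))
      (sub_nonneg.mpr hx1)
    have h7 := mul_le_mul_of_nonneg_right h4 hw
    linarith [h3 a]

open Classical in
theorem le_of_coeff_ne_zero (hf : newtonPolytope f = ∑ t, elementary (q t) (k t))
    {i : Fin d →₀ ℕ} {j : ℕ} (hij : MvPowerSeries.coeff i (f.coeff j) ≠ 0) :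
    ∑ t with q t = ⊤, k t ≤ j := by
  have hmem := mem_newtonPolytope_of_le hij le_rfl
  rw [hf] at hmem
  obtain ⟨p, hp, hsum⟩ := (Set.mem_finsetSum _ _ _).mp hmem
  have h2 : ∑ t, (p t).2 = j := by
    have := congrArg Prod.snd hsum
    rwa [Prod.snd_sum] at this
  have : ((∑ t with q t = ⊤, k t : ℕ) : ℝ) ≤ j := by
    rw [← h2, Nat.cast_sum, Finset.sum_filter]
    refine Finset.sum_le_sum fun t ht => ?_
    have hpt := hp ht
    split_ifs with h
    · rw [h, mem_elementary_top] at hpt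
      exact hpt.2
    · exact (nonneg_of_mem_elementary hpt).2
  exact_mod_cast this

open Classical in
/-- A Weierstrass polynomial whose Newton polytope is a sum of elementary polytopes with comparable
inclinations is a power of `y` times a polynomial with the corresponding slopes. -/
theorem exists_eq_X_pow_mul_of_newtonPolytope_eq (hW : IsWeierstrass f) (hk : ∀ t, 0 < k t)
    (hf : newtonPolytope f = ∑ t, elementary (q t) (k t))
    (hchain : ∀ s t, q s ≠ ⊤ → q t ≠ ⊤ → (∀ a, realVec (q s) a / k s ≤ realVec (q t) a / k t) ∨
      ∀ a, realVec (q t) a / k t ≤ realVec (q s) a / k s) :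
    ∃ g, f = X ^ (∑ t with q t = ⊤, k t) * g ∧
      HasSlopes {t | q t ≠ ⊤ ∧ q t ≠ 0} (fun t a => realVec (q t) a / k t) k g := by
  set v : ι → Fin d → ℝ := fun t a => realVec (q t) a / k t with hv
  set S : Finset ι := {t | q t ≠ ⊤ ∧ q t ≠ 0} with hS
  set N := ∑ t with q t = ⊤, k t with hN
  have hk' : ∀ t, (0 : ℝ) < k t := fun t => by exact_mod_cast hk t
  have hkv : ∀ t a, (k t : ℝ) * v t a = realVec (q t) a :=
    fun t a => mul_div_cancel₀ _ (hk' t).ne'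
  have hv0 : ∀ t a, 0 ≤ v t a := fun t a => div_nonneg (realVec_nonneg _ _) (hk' t).le
  have hvz : ∀ t, q t = 0 → v t = 0 := by
    intro t h
    funext a
    simp [hv, h, realVec_zero]
  have hkn : ∀ t, (k t : ℝ) * ∑ a, v t a = ∑ a, realVec (q t) a := by
    intro t
    rw [Finset.mul_sum]
    exact Finset.sum_congr rfl fun a _ => hkv t a
  have hpos : ∀ t, q t ≠ ⊤ → q t ≠ 0 → 0 < ∑ a, v t a := by
    intro t h1 h2
    obtain ⟨u, hu⟩ := WithTop.ne_top_iff_exists.mp h1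
    refine lt_of_le_of_ne (Finset.sum_nonneg fun a _ => hv0 t a) fun h => h2 ?_
    have h3 := (Finset.sum_eq_zero_iff_of_nonneg fun a _ => hv0 t a).mp h.symm
    rw [← hu]
    have : u = 0 := by
      funext a
      have h4 := hkv t a
      rw [h3 a (Finset.mem_univ a), mul_zero, ← hu, realVec_coe] at h4
      have : (0 : ℚ≥0) = u a := by exact_mod_cast h4
      rw [← this]; rfl
    rw [this]; rfl
  -- the vertices of the polytope below a given total inclination
  have hvert : ∀ μ : ℝ, 0 ≤ μ → ∃ i : Fin d →₀ ℕ,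
      MvPowerSeries.coeff i (f.coeff ((∑ t ∈ S with ¬ ∑ a, v t a ≤ μ, k t) + N)) ≠ 0 ∧
      ∀ a, (i a : ℝ) = ∑ t ∈ S with ∑ a, v t a ≤ μ, k t * v t a := by
    intro μ hμ
    obtain ⟨l, hl, hlt⟩ := exists_gt_avoiding (fun t => ∑ a, v t a) μ
    have hl0 : 0 < l := hμ.trans_lt hl
    have hiff : ∀ t, ∑ a, realVec (q t) a < l * k t ↔ ∑ a, v t a ≤ μ := by
      intro t
      rw [← hkn, mul_comm, mul_lt_mul_iff_left₀ (hk' t)]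
      exact ⟨fun h => (hlt t).resolve_right h.not_gt, fun h => h.trans_lt hl⟩
    obtain ⟨i, hi, hia⟩ := exists_support_vertex hf hl0 (fun t => by
      right
      rcases hlt t with h | h
      · exact Or.inl ((hiff t).mpr h)
      · right
        rw [← hkn, mul_comm l]
        exact mul_lt_mul_of_pos_left h (hk' t))
    simp only [hiff] at hi hia
    refine ⟨i, ?_, fun a => ?_⟩
    · convert hi using 3
      rw [hN, hS, Finset.filter_filter, Finset.sum_filter, Finset.sum_filter, Finset.sum_filter,
        ← Finset.sum_add_distrib]
      refine Finset.sum_congr rfl fun t _ => ?_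
      by_cases h1 : q t = ⊤
      · simp [h1]
      by_cases h2 : q t = 0
      · have : ∑ a, v t a ≤ μ := by rw [hvz t h2]; simpa using hμ
        simp [h2, this]
      · simp [h1, h2]
    · rw [hia, hS, Finset.filter_filter, Finset.sum_filter, Finset.sum_filter]
      refine Finset.sum_congr rfl fun t _ => ?_
      by_cases h1 : q t = ⊤
      · simp [h1]
      by_cases h2 : q t = 0
      · simp [h2, realVec_zero, hvz t h2]
      · simp [h1, h2, hkv]
  -- The vertex for `μ = 0` has exponent `i = 0`, so its coefficient is a unit; for a Weierstrass
  -- polynomial this must be the leading one.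
  have hdeg : f.natDegree = (∑ t ∈ S, k t) + N := by
    obtain ⟨i, hi, hia⟩ := hvert 0 le_rfl
    have hSpos : ∀ t ∈ S, ¬ ∑ a, v t a ≤ 0 := by
      intro t ht
      obtain ⟨-, h1, h2⟩ := Finset.mem_filter.mp ht
      exact not_le.mpr (hpos t h1 h2)
    rw [Finset.filter_true_of_mem hSpos] at hi
    rw [Finset.filter_false_of_mem hSpos] at hia
    obtain rfl : i = 0 := by
      ext a
      have := hia a
      rw [Finset.sum_empty] at this
      exact_mod_cast this
    refine le_antisymm (not_lt.mp fun hlt => ?_)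
      (le_natDegree_of_ne_zero fun h0 => hi (by simp [h0]))
    refine hW.2 _ hlt ?_
    rw [MvPowerSeries.isUnit_iff_constantCoeff, isUnit_iff_ne_zero,
      ← MvPowerSeries.coeff_zero_eq_constantCoeff_apply]
    exact hi
  obtain ⟨g, rfl⟩ : X ^ N ∣ f := by
    rw [X_pow_dvd_iff]
    intro j hj
    ext i
    by_contra hne
    exact absurd (le_of_coeff_ne_zero hf (by simpa using hne)) (not_le.mpr hj)
  have hg : g.Monic := (monic_X_pow N).of_mul_monic_left hW.1
  have hle_iff : ∀ s ∈ S, ∀ t ∈ S, (∑ a, v t a ≤ ∑ a, v s a ↔ v t ≤ v s) := by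
    intro s hs t ht
    refine ⟨fun h => ?_, fun h => Finset.sum_le_sum fun a _ => h a⟩
    rcases hchain t s (Finset.mem_filter.mp ht).2.1 (Finset.mem_filter.mp hs).2.1 with h' | h'
    · exact h'
    · have heq := le_antisymm h (Finset.sum_le_sum fun a _ => h' a)
      have := (Finset.sum_eq_sum_iff_of_le fun a _ => h' a).mp heq.symm
      intro a
      exact (this a (Finset.mem_univ a)).ge
  refine ⟨g, rfl, hg, ?_, ?_, ?_⟩
  · rw [(monic_X_pow N).natDegree_mul hg, natDegree_X_pow] at hdeg
    omega
  · intro s hs i j hij a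
    have hij' : MvPowerSeries.coeff i ((X ^ N * g).coeff (j + N)) ≠ 0 := by
      rwa [coeff_X_pow_mul]
    have := sum_min_le hf hij' a (hv0 s a)
    -- Infinite terms give `N * v s a`, which the shift by `y^N` cancels; terms of zero inclination
    -- give nothing.
    have e : (∑ t, if q t = ⊤ then k t * v s a else min (realVec (q t) a) (k t * v s a)) =
        (∑ t ∈ S, k t * min (v t a) (v s a)) + N * v s a := by
      rw [hN, Nat.cast_sum, Finset.sum_mul, hS, Finset.sum_filter, Finset.sum_filter,
        ← Finset.sum_add_distrib]
      refine Finset.sum_congr rfl fun t _ => ?_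
      by_cases h1 : q t = ⊤
      · simp [h1]
      by_cases h2 : q t = 0
      · simp [h2, realVec_zero, mul_nonneg (hk' t).le (hv0 s a)]
      · simp [h1, h2, mul_min_of_nonneg _ _ (hk' t).le, hkv]
    rw [e] at this
    push_cast at this
    linarith
  · intro s hs
    obtain ⟨i, hi, hia⟩ := hvert (∑ a, v s a) (Finset.sum_nonneg fun a _ => hv0 s a)
    rw [coeff_X_pow_mul] at hi
    refine ⟨i, ?_, fun a => ?_⟩
    · rwa [Finset.filter_congr fun t ht => not_congr (hle_iff s hs t ht)] at hi
    · rw [hia, Finset.filter_congr fun t ht => hle_iff s hs t ht]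

end Representation

end NewtonPoly

/-! ### Assembling the factorization. -/

theorem mainTheorem9 {K : Type*} [Field K] {d r : ℕ}
    (f : Polynomial (MvPowerSeries (Fin d) K)) (hf : NewtonPoly.IsWeierstrass f)
    (hpoly : NewtonPoly.IsPolygonal (NewtonPoly.newtonPolytope f))
    (q : Fin r → WithTop (Fin d → ℚ≥0)) (k : Fin r → ℕ)
    (hrep : NewtonPoly.IsCanonicalRep (NewtonPoly.newtonPolytope f) q k) :
    ∃ g : Fin r → Polynomial (MvPowerSeries (Fin d) K),
      f = ∏ i, g i ∧
      ∀ i, NewtonPoly.IsWeierstrass (g i) ∧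
        NewtonPoly.newtonPolytope (g i) = NewtonPoly.elementary (q i) (k i) := by
  classical
  open NewtonPoly Polynomial in
  obtain ⟨hk, hinj, hP⟩ := hrep
  have hk' : ∀ t, (0 : ℝ) < k t := fun t => by exact_mod_cast hk t
  have hchain : ∀ s t, q s ≠ ⊤ → q t ≠ ⊤ →
      (∀ a, realVec (q s) a / k s ≤ realVec (q t) a / k t) ∨
      ∀ a, realVec (q t) a / k t ≤ realVec (q s) a / k s := by
    intro s t hs ht
    obtain ⟨u, hu⟩ := WithTop.ne_top_iff_exists.mp hs
    obtain ⟨u', hu'⟩ := WithTop.ne_top_iff_exists.mp ht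
    rw [hP] at hpoly
    rw [← hu, ← hu']
    exact comparable_of_isPolygonal hk hpoly hu.symm hu'.symm
  obtain ⟨p, hp, hslopes⟩ := exists_eq_X_pow_mul_of_newtonPolytope_eq hf hk hP hchain
  obtain ⟨g, hg, hgs⟩ := exists_factorization_of_slopes _ k
    (fun t a => div_nonneg (realVec_nonneg _ _) (hk' t).le) _
    (fun s hs t ht => hchain s t (Finset.mem_filter.mp hs).2.1 (Finset.mem_filter.mp ht).2.1)
    -- Equal real slopes mean equal inclinations, which canonicity excludes.
    (by
      intro s hs t ht hst
      obtain ⟨u, hu⟩ := WithTop.ne_top_iff_exists.mp (Finset.mem_filter.mp hs).2.1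
      obtain ⟨u', hu'⟩ := WithTop.ne_top_iff_exists.mp (Finset.mem_filter.mp ht).2.1
      apply hinj
      simp only [← hu, ← hu', inclination_coe]
      congr 1
      funext a
      have := congrFun hst a
      simp only [← hu, ← hu', realVec_coe] at this
      exact_mod_cast this) hslopes
  refine ⟨fun t => if q t = ⊤ then X ^ k t else if q t = 0 then 1 else g t, ?_, fun t => ?_⟩
  · rw [hp, hg, ← Finset.prod_pow_eq_pow_sum, Finset.prod_filter, Finset.prod_filter,
      ← Finset.prod_mul_distrib]
    refine Finset.prod_congr rfl fun t _ => ?_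
    by_cases h1 : q t = ⊤
    · simp [h1]
    by_cases h2 : q t = 0
    · simp [h2]
    · simp [h1, h2]
  · by_cases h1 : q t = ⊤
    · simp only [h1, if_true]
      refine ⟨⟨monic_X_pow _, fun j hj => not_isUnit_of_coeff_zero ?_⟩, newtonPolytope_X_pow _⟩
      rw [natDegree_X_pow] at hj
      rw [coeff_X_pow, if_neg hj.ne, map_zero]
    by_cases h2 : q t = 0
    · simp only [h2, if_true]
      rw [if_neg (h2 ▸ h1)]
      exact ⟨⟨monic_one, by simp⟩, newtonPolytope_one _⟩
    · simp only [if_neg h1, if_neg h2]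
      have hs := hgs t (by simp [h1, h2])
      obtain ⟨u, hu⟩ := WithTop.ne_top_iff_exists.mp h1
      rw [← hu] at hs h2 ⊢
      have hu0 : u ≠ 0 := fun h => h2 (by rw [h]; rfl)
      obtain ⟨a, ha⟩ := Function.ne_iff.mp hu0
      refine ⟨hs.isWeierstrass (a := a) (div_pos ?_ (hk' t)), hs.newtonPolytope_eq (hk t)⟩
      have : 0 < u a := pos_iff_ne_zero.mpr ha
      rw [realVec_coe]
      exact_mod_cast this
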